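/- A double graph is a triple $(V,E_1,E_2)$, where $E_1,E_2$ are two sets of edges on the same vertex set $V$. Jigsaw percolation on it starts with the partition of $V$ into singletons. At each step, consider the graph whose vertices are the parts (clusters) of the current partition, two distinct clusters being adjacent if there are an edge of $E_1$ and an edge of $E_2$ each meeting both clusters; then all the clusters in each connected component of this graph are merged into one cluster, which gives the next partition. The double graph percolates if the process ends with the single cluster $V$. Theorem. There is an absolute constant $c>0$ such that the following holds. Let $p_1=p_1(n)$ and $p_2=p_2(n)$ be functions of $n$ with values in $[0,1]$, and for each $n$ let $G=(V,E_1,E_2)$, where $(V,E_1)=G(n,p_1)$ and $(V,E_2)=G(n,p_2)$ are independent Erdős–Rényi random graphs on the same set $V$ of $n$ vertices (each pair of vertices is an edge of $G(n,p)$ independently with probability $p$). (i) If $p_1p_2\le \dfrac{1}{c\,n\log n}$ for all sufficiently large $n$, then $\mathbb P(G\text{ percolates})\to 0$ as $n\to\infty$. (ii) If $p_1p_2\ge \dfrac{c}{n\log n}$ and $\min\{p_1,p_2\}\ge \dfrac{c\log n}{n}$ for all sufficiently large $n$, then $\mathbb P(G\text{ percolates})\to 1$ as $n\to\infty$. -/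

import Mathlib

open Filter Topology

namespace Jigsaw

/-- A double graph on the vertex set `V`: two edge sets (red and blue) on the same vertices. -/
structure DoubleGraph (V : Type*) where
  /-- The first (red) graph. -/
  red : SimpleGraph V
  /-- The second (blue) graph. -/
  blue : SimpleGraph V

variable {V : Type*}

/-- `G` has an edge meeting both of the clusters `A` and `B` of the partition `C`.
This is used for distinct clusters only, so that such an edge has one end in each. -/
def EdgeBetween (G : SimpleGraph V) (C : Setoid V) (A B : Quotient C) : Prop :=
  ∃ u v : V, Quotient.mk C u = A ∧ Quotient.mk C v = B ∧ G.Adj u v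

/-- The graph on the clusters of the partition `C` in which two distinct clusters are adjacent
if they are joined by at least one red edge and at least one blue edge. -/
def clusterGraph (G : DoubleGraph V) (C : Setoid V) : SimpleGraph (Quotient C) where
  Adj A B := A ≠ B ∧ EdgeBetween G.red C A B ∧ EdgeBetween G.blue C A B
  symm := ⟨by
    rintro A B ⟨hne, ⟨u, v, hu, hv, h⟩, ⟨x, y, hx, hy, k⟩⟩
    exact ⟨hne.symm, ⟨v, u, hv, hu, h.symm⟩, ⟨y, x, hy, hx, k.symm⟩⟩⟩
  loopless := ⟨fun _ h => h.1 rfl⟩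

/-- One step of the algorithm: the clusters of the new partition are the unions of the old
clusters over the connected components of the cluster graph. -/
def step (G : DoubleGraph V) (C : Setoid V) : Setoid V :=
  Setoid.comap (Quotient.mk C) (clusterGraph G C).reachableSetoid

/-- The partition at time `t`, starting from the partition into singletons. If the cluster graph
has no edges, or if there is a single cluster, then the partition does not change any more, so the
stopping rule of the algorithm does not have to be recorded. -/
def partitionAt (G : DoubleGraph V) : ℕ → Setoid V
  | 0 => ⊥
  | t + 1 => step G (partitionAt G t)

/-- The double graph percolates: the process reaches the partition with the single cluster `V`. -/
def Percolates (G : DoubleGraph V) : Prop :=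
  ∃ t : ℕ, partitionAt G t = ⊤

/-- The probability that the double graph formed by two independent Erdős–Rényi random graphs
`G(n, p₁)` and `G(n, p₂)` on the same `n` vertices percolates. -/
noncomputable def percolationProb (n : ℕ) (p₁ p₂ : unitInterval) : ℝ :=
  ((SimpleGraph.binomialRandom (Fin n) p₁).prod (SimpleGraph.binomialRandom (Fin n) p₂)).real
    {ω | Percolates ⟨ω.1, ω.2⟩}

end Jigsaw

open MeasureTheory ProbabilityTheory unitInterval

namespace Jigsaw

/-! Part (i) is a first moment argument. If the process is slowed down so that clusters merge two at
a time, and `k ≥ 2`, then a process that reaches `V` passes through a cluster `S` with `k ≤ |S| <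
2k`, since merging two clusters of size below `k` gives less than `2k`
(`exists_medium_of_percolates`). Such an `S` carries at least `|S| - 1` edges of each colour. For
`|S| = j + 1` the expected number of such sets is at most of order `n (e³ n (j+1) p₁p₂)^j`. With `k`
just above `log n` the base is at most `e⁻²` and `j ≥ log n`, so each size contributes `O(1/n)`.

Part (ii) grows one cluster, adding single vertices joined to it in both colours (`Grows`). By
symmetry `p₁ ≤ p₂`. The vertex set is split into reserves, so that each stage uses edges not yet
examined. Seed: starting from one vertex, reveal the red edges of the newest vertex, then the blue
edges from the cluster to about `1/(p₂L)` of its red neighbours. A cluster of size `k` survives such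
a step with probability at least `k/(4L)`, so size `L ≈ log n / 12` is reached with probability at
least `e^(-3L)`, roughly `n^(-1/4)`. The nearly `n` vertices allow about `n / log n` attempts, and
one of them succeeds (`real_noGrown_le`). The bound on `p₁p₂` makes room for the red neighbourhoods
needed here. Doubling: while `k p₂ < 1`, a fresh vertex is joined to a cluster of size `k` in both
colours with probability at least `p₁p₂k²/4`. This quadruples when `k` doubles, so geometrically
shrinking reserves suffice (`real_noGrown_doubling_le`). Once `k p₂ ≥ 1`, one more round gives size
`2 log n / p₂` (`real_noGrown_large_le`). Finish: this cluster has a blue edge to every vertex of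
the last reserve `Z`. Red is connected on `Z`, so red edges absorb `Z` one vertex after another;
finally `Z` sends both colours to every other vertex (`percolates_of_joined`). -/

/-- The law of a Bernoulli random proposition. -/
noncomputable def bernoulliProp (p : unitInterval) : Measure Prop :=
  toNNReal p • Measure.dirac True + toNNReal (σ p) • Measure.dirac False

instance (p : unitInterval) : IsProbabilityMeasure (bernoulliProp p) := by
  unfold bernoulliProp
  infer_instance

lemma bernoulliProp_real_true (p : unitInterval) : (bernoulliProp p).real {True} = p := by
  simp [bernoulliProp, measureReal_def]

lemma bernoulliProp_real_false (p : unitInterval) : (bernoulliProp p).real {False} = 1 - p := by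
  simp [bernoulliProp, measureReal_def]

/-! ### Independence and tail bounds for families of Bernoulli variables -/

section Product

variable {E : Type*} [Fintype E]

/-- The law of a family of independent Bernoulli random propositions. -/
noncomputable def bernoulliPi (p : E → unitInterval) : Measure (E → Prop) :=
  Measure.pi fun e => bernoulliProp (p e)

instance (p : E → unitInterval) : IsProbabilityMeasure (bernoulliPi p) := by
  unfold bernoulliPi; infer_instance

instance : DiscreteMeasurableSpace (E → Prop) := MeasurableSingletonClass.toDiscreteMeasurableSpace

lemma real_mono (p : E → unitInterval) {A B : Set (E → Prop)} (h : A ⊆ B) :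
    (bernoulliPi p).real A ≤ (bernoulliPi p).real B :=
  measureReal_mono h

/-- Events that are determined by disjoint sets of coordinates are independent. -/
lemma bernoulliPi_inter (p : E → unitInterval) {A B : Set (E → Prop)} {S T : Set E}
    (hA : DependsOn (fun ω => ω ∈ A) S) (hB : DependsOn (fun ω => ω ∈ B) T)
    (hST : Disjoint S T) :
    (bernoulliPi p).real (A ∩ B) = (bernoulliPi p).real A * (bernoulliPi p).real B := by
  classical
  have hind : iIndepFun (fun (i : E) (ω : E → Prop) ↦ ω i) (bernoulliPi p) :=
    iIndepFun_pi (X := fun _ => id) (fun i ↦ aemeasurable_id)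
  have h := hind.indepFun_finset S.toFinset T.toFinset (by simpa using hST)
    (fun i ↦ measurable_pi_apply i)
  -- An event that depends only on `S` is the preimage of its own image under restriction to `S`,
  -- which brings it into the form required by `indepFun_finset`.
  have key : ∀ {A : Set (E → Prop)} {S : Set E}, DependsOn (fun ω => ω ∈ A) S →
      A = (fun (ω : E → Prop) (i : S.toFinset) ↦ ω i) ⁻¹'
        ((fun (ω : E → Prop) (i : S.toFinset) ↦ ω i) '' A) := by
    intro A S hA
    refine Set.Subset.antisymm (Set.subset_preimage_image _ _) ?_
    rintro ω ⟨ω', h', heq⟩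
    have := hA (x := ω') (y := ω) (fun i hi => congrFun heq ⟨i, by simpa using hi⟩)
    exact this.mp h'
  rw [key hA, key hB]
  simp only [measureReal_def, ← ENNReal.toReal_mul]
  congr 1
  exact h.measure_inter_preimage_eq_mul _ _ .of_discrete .of_discrete

lemma bernoulliPi_forall (p : E → unitInterval) (F : Finset E) :
    (bernoulliPi p).real {ω | ∀ e ∈ F, ω e} = ∏ e ∈ F, (p e : ℝ) := by
  classical
  have : {ω : E → Prop | ∀ e ∈ F, ω e} =
      Set.univ.pi fun e => if e ∈ F then {True} else Set.univ := by
    ext ω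
    simp only [Set.mem_ofPred_eq, Set.mem_pi, Set.mem_univ, forall_true_left]
    refine forall_congr' fun e => ?_
    split_ifs with h <;> simp [h]
  rw [this, measureReal_def, bernoulliPi, Measure.pi_pi, ENNReal.toReal_prod,
    ← Finset.prod_subset (Finset.subset_univ F)]
  · refine Finset.prod_congr rfl fun e he => ?_
    rw [if_pos he, ← measureReal_def, bernoulliProp_real_true]
  · intro e _ he
    simp [he]

lemma bernoulliPi_forall_not (p : E → unitInterval) (F : Finset E) :
    (bernoulliPi p).real {ω | ∀ e ∈ F, ¬ ω e} = ∏ e ∈ F, (1 - p e : ℝ) := by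
  classical
  have : {ω : E → Prop | ∀ e ∈ F, ¬ ω e} =
      Set.univ.pi fun e => if e ∈ F then {False} else Set.univ := by
    ext ω
    simp only [Set.mem_ofPred_eq, Set.mem_pi, Set.mem_univ, forall_true_left]
    refine forall_congr' fun e => ?_
    split_ifs with h <;> simp [h]
  rw [this, measureReal_def, bernoulliPi, Measure.pi_pi, ENNReal.toReal_prod,
    ← Finset.prod_subset (Finset.subset_univ F)]
  · refine Finset.prod_congr rfl fun e he => ?_
    rw [if_pos he, ← measureReal_def, bernoulliProp_real_false]
  · intro e _ he
    simp [he]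

lemma sum_fiber_real (p : E → unitInterval) {τ : Type*} [Fintype τ] (f : (E → Prop) → τ)
    (A : Set (E → Prop)) :
    (bernoulliPi p).real A = ∑ t, (bernoulliPi p).real (f ⁻¹' {t} ∩ A) := by
  classical
  have : A = ⋃ t ∈ (Finset.univ : Finset τ), f ⁻¹' {t} ∩ A := by
    ext ω; simp
  conv_lhs => rw [this]
  refine measureReal_biUnion_finset ?_ fun _ _ => .of_discrete
  intro s _ t _ hst
  refine Set.disjoint_left.2 ?_
  rintro ω ⟨hs, _⟩ ⟨ht, _⟩
  exact hst (hs.symm.trans ht)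

/-- The law of total probability, for an upper bound of conditional probabilities: given `f = t`,
the event `A` is contained in an event `H t` that is independent of the value of `f`. -/
lemma real_le_sum_fiber (p : E → unitInterval) {τ : Type*} [Fintype τ] (f : (E → Prop) → τ)
    (A : Set (E → Prop)) (H : τ → Set (E → Prop)) (S T : τ → Set E)
    (hf : ∀ t, DependsOn (fun ω => ω ∈ f ⁻¹' {t}) (S t))
    (hH : ∀ t, DependsOn (fun ω => ω ∈ H t) (T t)) (hST : ∀ t, Disjoint (S t) (T t))
    (hA : ∀ t, ∀ ω ∈ A, f ω = t → ω ∈ H t) :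
    (bernoulliPi p).real A ≤
      ∑ t, (bernoulliPi p).real (f ⁻¹' {t}) * (bernoulliPi p).real (H t) := by
  rw [sum_fiber_real p f A]
  refine Finset.sum_le_sum fun t _ => ?_
  rw [← bernoulliPi_inter p (hf t) (hH t) (hST t)]
  exact measureReal_mono fun ω hω => ⟨hω.1, hA t ω hω.2 hω.1⟩

lemma real_compl (p : E → unitInterval) (A : Set (E → Prop)) :
    (bernoulliPi p).real Aᶜ = 1 - (bernoulliPi p).real A := by
  rw [probReal_compl_eq_one_sub .of_discrete]

omit [Fintype E] in
lemma dependsOn_compl {A : Set (E → Prop)} {S : Set E} (h : DependsOn (fun ω => ω ∈ A) S) :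
    DependsOn (fun ω => ω ∈ Aᶜ) S := by
  intro x y hxy
  exact congrArg Not (h hxy)

/-- A lower tail bound for the number of those of the independent events `G v`, `v ∈ Y`,
that occur. -/
lemma real_card_lt_le {V : Type*} [DecidableEq V] (p : E → unitInterval) (G : V → Set (E → Prop))
    (S : V → Set E) (hG : ∀ v, DependsOn (fun ω => ω ∈ G v) (S v)) {q : ℝ} (Y : Finset V)
    (hS : ∀ v ∈ Y, ∀ w ∈ Y, v ≠ w → Disjoint (S v) (S w)) (hq1 : q ≤ 2)
    (hq : ∀ v ∈ Y, q ≤ (bernoulliPi p).real (G v)) (m : ℕ) :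
    (bernoulliPi p).real {ω | ¬ ∃ R ⊆ Y, m ≤ R.card ∧ ∀ v ∈ R, ω ∈ G v} ≤
      2 ^ m * (1 - q / 2) ^ Y.card := by
  induction Y using Finset.induction_on generalizing m with
  | empty =>
    simp only [Finset.card_empty, pow_zero, mul_one]
    exact measureReal_le_one.trans (one_le_pow₀ (by norm_num))
  | insert v Y hv ih =>
    have hdep : ∀ m : ℕ, DependsOn
        (fun ω => ω ∈ {ω | ¬ ∃ R ⊆ Y, m ≤ R.card ∧ ∀ v ∈ R, ω ∈ G v}) (⋃ w ∈ Y, S w) := by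
      intro m x y hxy
      have : ∀ w ∈ Y, (x ∈ G w) = (y ∈ G w) := fun w hw =>
        hG w fun i hi => hxy i (Set.mem_biUnion hw hi)
      simp only [Set.mem_ofPred_eq, eq_iff_iff, not_iff_not]
      refine exists_congr fun R => and_congr_right fun hR => and_congr_right fun _ => ?_
      exact forall₂_congr fun w hw => by rw [this w (hR hw)]
    have hdisj : Disjoint (S v) (⋃ w ∈ Y, S w) := by
      rw [Set.disjoint_iUnion₂_right]
      intro w hw
      exact hS v (by simp) w (by simp [hw]) (by rintro rfl; exact hv hw)
    have ih' := fun m => ih (fun a ha b hb => hS a (by simp [ha]) b (by simp [hb]))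
      (fun a ha => hq a (by simp [ha])) m
    have hqv := hq v (by simp)
    set g := (bernoulliPi p).real (G v) with hg
    have hnn : 0 ≤ (1 - q / 2) ^ Y.card := pow_nonneg (by linarith) _
    rcases m with _ | m
    · have : {ω : E → Prop | ¬ ∃ R ⊆ insert v Y, 0 ≤ R.card ∧ ∀ v ∈ R, ω ∈ G v} = ∅ := by
        ext ω
        simp only [Set.mem_ofPred_eq, Set.mem_empty_iff_false, iff_false, not_not]
        exact ⟨∅, by simp⟩
      rw [this, measureReal_empty]
      exact mul_nonneg (by positivity) (pow_nonneg (by linarith) _)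
    · have hsub : {ω : E → Prop | ¬ ∃ R ⊆ insert v Y, m + 1 ≤ R.card ∧ ∀ v ∈ R, ω ∈ G v} ⊆
          (G v ∩ {ω | ¬ ∃ R ⊆ Y, m ≤ R.card ∧ ∀ v ∈ R, ω ∈ G v}) ∪
          ((G v)ᶜ ∩ {ω | ¬ ∃ R ⊆ Y, m + 1 ≤ R.card ∧ ∀ v ∈ R, ω ∈ G v}) := by
        intro ω hω
        by_cases hωv : ω ∈ G v
        · refine Or.inl ⟨hωv, ?_⟩
          rintro ⟨R, hR, hm, hRG⟩
          refine hω ⟨insert v R, Finset.insert_subset_insert _ hR, ?_, ?_⟩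
          · rw [Finset.card_insert_of_notMem fun h => hv (hR h)]; omega
          · intro w hw
            rcases Finset.mem_insert.1 hw with rfl | hw
            · exact hωv
            · exact hRG w hw
        · refine Or.inr ⟨hωv, ?_⟩
          rintro ⟨R, hR, hm, hRG⟩
          exact hω ⟨R, hR.trans (Finset.subset_insert _ _), hm, hRG⟩
      refine (measureReal_mono hsub).trans ((measureReal_union_le _ _).trans ?_)
      rw [bernoulliPi_inter p (hG v) (hdep m) hdisj,
        bernoulliPi_inter p (dependsOn_compl (hG v)) (hdep (m + 1)) hdisj, real_compl, ← hg,
        Finset.card_insert_of_notMem hv]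
      have h1 : g ≤ 1 := measureReal_le_one
      have h0 : 0 ≤ g := measureReal_nonneg
      calc g * _ + (1 - g) * _ ≤ g * (2 ^ m * (1 - q / 2) ^ Y.card) +
            (1 - g) * (2 ^ (m + 1) * (1 - q / 2) ^ Y.card) := by
            have : 0 ≤ 1 - g := by linarith
            gcongr
            · exact ih' m
            · exact ih' (m + 1)
        -- This is Markov's inequality for `2 ^ (-N)`, where `N` counts the events that occur: each
        -- event contributes a factor `1 - g / 2` to the expectation.
        _ = (2 ^ (m + 1) * (1 - q / 2) ^ Y.card) * (1 - g / 2) := by ring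
        _ ≤ (2 ^ (m + 1) * (1 - q / 2) ^ Y.card) * (1 - q / 2) := by
            gcongr
        _ = _ := by ring

end Product

/-! ### The random double graph as a product measure -/

section Law

variable {V : Type*}

/-- Indices of the edges of a double graph; the first component is `true` for the red edges. -/
abbrev Edge (V : Type*) := Bool × Sym2 V

/-- The double graph whose red and blue edges are listed by `ω`. -/
def toDouble (ω : Edge V → Prop) : DoubleGraph V :=
  ⟨SimpleGraph.fromEdgeSet {e | ω (true, e)}, SimpleGraph.fromEdgeSet {e | ω (false, e)}⟩

open Classical in
/-- The probability `p` on the pairs of distinct vertices, and `0` on the diagonal. -/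
noncomputable def offDiagProb (p : unitInterval) (e : Sym2 V) : unitInterval :=
  if e.IsDiag then 0 else p

/-- The edge probabilities of the random double graph, on all pairs including the diagonal. -/
noncomputable def edgeProb (p₁ p₂ : unitInterval) (e : Edge V) : unitInterval :=
  offDiagProb (if e.1 then p₁ else p₂) e.2

lemma binomialRandom_eq_map_bernoulliPi [Fintype V] (p : unitInterval) :
    SimpleGraph.binomialRandom V p =
      (bernoulliPi (offDiagProb (V := V) p)).map fun f => SimpleGraph.fromEdgeSet {e | f e} := by
  rw [SimpleGraph.binomialRandom_eq_map, setBernoulli_eq_map,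
    Measure.map_map SimpleGraph.measurable_fromEdgeSet (Measurable.of_discrete),
    Measure.infinitePi_eq_pi]
  simp only [bernoulliPi, offDiagProb]
  congr 2
  funext e
  by_cases h : e.IsDiag
  · have he : (e ∈ (Sym2.diagSetᶜ : Set (Sym2 V))) = False := by simpa using h
    -- On the diagonal both outcomes are `False`, so the two Dirac masses add up to a single one.
    have : toNNReal p + toNNReal (σ p) = 1 := by ext; simp
    simp only [bernoulliProp, h, if_true, he]
    rw [← add_smul, this]
    simp
  · simp [bernoulliProp, h]

instance [Finite V] : MeasurableSingletonClass (SimpleGraph V) where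
  measurableSet_singleton G :=
    ⟨{G.Adj}, measurableSet_singleton _, by ext H; simp⟩

lemma prod_bernoulliPi_eq_map [Fintype V] (p₁ p₂ : unitInterval) :
    (bernoulliPi (offDiagProb (V := V) p₁)).prod (bernoulliPi (offDiagProb (V := V) p₂)) =
      (bernoulliPi (edgeProb (V := V) p₁ p₂)).map
        fun ω => (fun e => ω (true, e), fun e => ω (false, e)) := by
  refine Measure.ext_of_singleton fun ⟨f, g⟩ => ?_
  have : (fun ω : Edge V → Prop => ((fun e => ω (true, e)), (fun e => ω (false, e)))) ⁻¹' {(f, g)} =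
      {fun e => if e.1 then f e.2 else g e.2} := by
    ext ω
    simp only [Set.mem_preimage, Set.mem_singleton_iff, Prod.mk.injEq]
    constructor
    · rintro ⟨rfl, rfl⟩
      funext ⟨b, e⟩
      cases b <;> simp
    · rintro rfl
      simp
  rw [Measure.map_apply .of_discrete (measurableSet_singleton _), this, ← Set.singleton_prod_singleton,
    Measure.prod_prod]
  simp only [bernoulliPi, Measure.pi_singleton, Fintype.prod_prod_type, Fintype.prod_bool, edgeProb]
  simp

/-- Puts both colours on one product space, where events that depend on disjoint sets of coloured
edges are independent. -/
lemma percolationProb_eq (n : ℕ) (p₁ p₂ : unitInterval) :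
    percolationProb n p₁ p₂ =
      (bernoulliPi (edgeProb (V := Fin n) p₁ p₂)).real {ω | Percolates (toDouble ω)} := by
  have hm : Measurable fun f : Sym2 (Fin n) → Prop => SimpleGraph.fromEdgeSet {e | f e} :=
    .of_discrete
  unfold percolationProb
  rw [binomialRandom_eq_map_bernoulliPi, binomialRandom_eq_map_bernoulliPi,
    Measure.map_prod_map _ _ hm hm, prod_bernoulliPi_eq_map,
    Measure.map_map (hm.prodMap hm) .of_discrete,
    measureReal_def, measureReal_def, Measure.map_apply .of_discrete .of_discrete]
  rfl

lemma clusterGraph_swap (G : DoubleGraph V) (C : Setoid V) :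
    clusterGraph ⟨G.blue, G.red⟩ C = clusterGraph G C := by
  ext A B
  simp only [clusterGraph]
  tauto

lemma partitionAt_swap (G : DoubleGraph V) (t : ℕ) :
    partitionAt ⟨G.blue, G.red⟩ t = partitionAt G t := by
  induction t with
  | zero => rfl
  | succ t ih => 
    change step _ _ = step _ _
    rw [ih]
    simp only [step, clusterGraph_swap]

/-- The process treats the colours alike. This allows `p₁ ≤ p₂` to be assumed in the supercritical
part. -/
lemma percolationProb_symm (n : ℕ) (p₁ p₂ : unitInterval) :
    percolationProb n p₁ p₂ = percolationProb n p₂ p₁ := by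
  unfold percolationProb
  rw [← Measure.prod_swap, measureReal_def, measureReal_def,
    Measure.map_apply measurable_swap .of_discrete]
  congr 2
  ext ω
  simp only [Set.mem_preimage, Set.mem_ofPred_eq, Percolates, Prod.fst_swap, Prod.snd_swap]
  exact exists_congr fun t => by rw [← partitionAt_swap]

end Law

/-! ### Clusters of medium size in a percolating double graph -/

section Rich

variable {V : Type*}

/-- The graph `G` has at least as many edges inside `S` as a tree on `S`. -/
def TreeManyEdges (G : SimpleGraph V) (S : Finset V) : Prop :=
  ∃ T : Finset (Sym2 V), T.card + 1 = S.card ∧ ∀ e ∈ T, e ∈ G.edgeSet ∧ ∀ v ∈ e, v ∈ S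

lemma treeManyEdges_singleton (G : SimpleGraph V) (v : V) : TreeManyEdges G {v} :=
  ⟨∅, by simp, by simp⟩

/-- The edge `uv` crosses between the disjoint sets, so it is new, and `(|S₁| - 1) + (|S₂| - 1) + 1
= |S₁ ∪ S₂| - 1`. -/
lemma TreeManyEdges.union [DecidableEq V] {G : SimpleGraph V} {S₁ S₂ : Finset V}
    (h₁ : TreeManyEdges G S₁) (h₂ : TreeManyEdges G S₂) (hd : Disjoint S₁ S₂) {u v : V}
    (hu : u ∈ S₁) (hv : v ∈ S₂) (huv : G.Adj u v) : TreeManyEdges G (S₁ ∪ S₂) := by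
  obtain ⟨T₁, hc₁, hT₁⟩ := h₁
  obtain ⟨T₂, hc₂, hT₂⟩ := h₂
  have hTd : Disjoint T₁ T₂ := by
    rw [Finset.disjoint_left]
    intro e he₁ he₂
    induction e with
    | _ a b =>
      exact Finset.disjoint_left.1 hd ((hT₁ _ he₁).2 a (Sym2.mem_mk_left a b))
        ((hT₂ _ he₂).2 a (Sym2.mem_mk_left a b))
  have hn : s(u, v) ∉ T₁ ∪ T₂ := by
    intro h
    rcases Finset.mem_union.1 h with h | h
    · exact Finset.disjoint_left.1 hd ((hT₁ _ h).2 v (Sym2.mem_mk_right u v)) hv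
    · exact Finset.disjoint_left.1 hd hu ((hT₂ _ h).2 u (Sym2.mem_mk_left u v))
  refine ⟨insert s(u, v) (T₁ ∪ T₂), ?_, ?_⟩
  · rw [Finset.card_insert_of_notMem hn, Finset.card_union_of_disjoint hTd,
      Finset.card_union_of_disjoint hd]
    omega
  · intro e he
    rcases Finset.mem_insert.1 he with rfl | he
    · refine ⟨huv, fun w hw => ?_⟩
      rcases Sym2.mem_iff.1 hw with rfl | rfl
      · exact Finset.mem_union_left _ hu
      · exact Finset.mem_union_right _ hv
    · rcases Finset.mem_union.1 he with he | he
      · exact ⟨(hT₁ e he).1, fun w hw => Finset.mem_union_left _ ((hT₁ e he).2 w hw)⟩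
      · exact ⟨(hT₂ e he).1, fun w hw => Finset.mem_union_right _ ((hT₂ e he).2 w hw)⟩

/-- One step may merge many clusters at once, so the merging is done one cluster at a time: among
the small, edge-rich unions of old clusters reachable from `v`, take a largest one, `S`. Adding an
adjacent old cluster keeps it edge-rich and of size below `2k`, hence below `k` by `hno`, which
contradicts maximality. So `S` is closed under adjacency and is the whole new cluster. -/
lemma clusters_small [Fintype V] [DecidableEq V] (G : DoubleGraph V) {k : ℕ} (hk : 2 ≤ k)
    (hno : ∀ S : Finset V, k ≤ S.card → S.card < 2 * k → TreeManyEdges G.red S →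
      ¬ TreeManyEdges G.blue S) (t : ℕ) (v : V) :
    ∃ S : Finset V, (∀ w, w ∈ S ↔ partitionAt G t v w) ∧ S.card < k ∧
      TreeManyEdges G.red S ∧ TreeManyEdges G.blue S := by
  classical
  induction t generalizing v with
  | zero =>
    refine ⟨{v}, fun w => ?_, by simp; omega, treeManyEdges_singleton _ _,
      treeManyEdges_singleton _ _⟩
    change w ∈ ({v} : Finset V) ↔ v = w
    rw [Finset.mem_singleton, eq_comm]
  | succ t ih =>
    set C := partitionAt G t with hC
    choose cl hcl hclk hclr hclb using ih
    have hrel : ∀ w, partitionAt G (t + 1) v w ↔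
        (clusterGraph G C).Reachable (Quotient.mk C v) (Quotient.mk C w) := fun w => Iff.rfl
    let F : Finset (Finset V) := Finset.univ.filter fun S => v ∈ S ∧ S.card < k ∧
      TreeManyEdges G.red S ∧ TreeManyEdges G.blue S ∧
      (∀ w ∈ S, (clusterGraph G C).Reachable (Quotient.mk C v) (Quotient.mk C w)) ∧
      ∀ w ∈ S, ∀ x, C w x → x ∈ S
    have hF : F.Nonempty := by
      refine ⟨cl v, ?_⟩
      simp only [F, Finset.mem_filter, Finset.mem_univ, true_and]
      refine ⟨(hcl v v).2 (C.refl v), hclk v, hclr v, hclb v, fun w hw => ?_, fun w hw x hx => ?_⟩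
      · rw [Quotient.sound ((hcl v w).1 hw : v ≈ w)]
      · exact (hcl v x).2 (C.trans ((hcl v w).1 hw) hx)
    obtain ⟨S, hSF, hmax⟩ := F.exists_max_image Finset.card hF
    simp only [F, Finset.mem_filter, Finset.mem_univ, true_and] at hSF hmax
    obtain ⟨hvS, hSk, hSr, hSb, hSreach, hSsat⟩ := hSF
    have hclosed : ∀ w ∈ S, ∀ x, (clusterGraph G C).Adj (Quotient.mk C w) (Quotient.mk C x) →
        x ∈ S := by
      intro w hw x hadj
      by_contra hx
      have hd : Disjoint S (cl x) := by
        rw [Finset.disjoint_left]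
        intro y hy hyx
        exact hx (hSsat y hy x (C.symm ((hcl x y).1 hyx)))
      obtain ⟨hne, ⟨a, b, ha, hb, hab⟩, ⟨a', b', ha', hb', hab'⟩⟩ := hadj
      have hr : TreeManyEdges G.red (S ∪ cl x) := hSr.union (hclr x) hd
        (hSsat w hw a (C.symm (Quotient.exact ha)))
        ((hcl x b).2 (C.symm (Quotient.exact hb))) hab
      have hbl : TreeManyEdges G.blue (S ∪ cl x) := hSb.union (hclb x) hd
        (hSsat w hw a' (C.symm (Quotient.exact ha')))
        ((hcl x b').2 (C.symm (Quotient.exact hb'))) hab'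
      have hcard := Finset.card_union_of_disjoint hd
      have hxx : x ∈ cl x := (hcl x x).2 (C.refl x)
      have hpos : 0 < (cl x).card := Finset.card_pos.2 ⟨x, hxx⟩
      have hlt : (S ∪ cl x).card < k := by
        by_contra hge
        exact hno _ (not_lt.1 hge) (by have := hclk x; omega) hr hbl
      have := hmax (S ∪ cl x) ⟨Finset.mem_union_left _ hvS, hlt, hr, hbl, ?_, ?_⟩
      · omega
      · intro y hy
        rcases Finset.mem_union.1 hy with hy | hy
        · exact hSreach y hy
        · rw [← Quotient.sound ((hcl x y).1 hy : x ≈ y)]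
          exact (hSreach w hw).trans (SimpleGraph.Adj.reachable
            ⟨hne, ⟨a, b, ha, hb, hab⟩, ⟨a', b', ha', hb', hab'⟩⟩)
      · intro y hy z hz
        rcases Finset.mem_union.1 hy with hy | hy
        · exact Finset.mem_union_left _ (hSsat y hy z hz)
        · exact Finset.mem_union_right _ ((hcl x z).2 (C.trans ((hcl x y).1 hy) hz))
    refine ⟨S, fun w => ⟨fun hw => (hrel w).2 (hSreach w hw), fun hw => ?_⟩, hSk, hSr, hSb⟩
    have hr := (hrel w).1 hw
    rw [SimpleGraph.reachable_iff_reflTransGen] at hr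
    have key : ∀ B, Relation.ReflTransGen (clusterGraph G C).Adj (Quotient.mk C v) B →
        ∀ x, Quotient.mk C x = B → x ∈ S := by
      intro B hB
      induction hB with
      | refl => exact fun x hx => hSsat v hvS x (C.symm (Quotient.exact hx))
      | @tail B D _ hBD ih =>
        rintro x rfl
        obtain ⟨y, rfl⟩ := Quotient.exists_rep B
        exact hclosed y (ih y rfl) x hBD
    exact key _ hr w rfl

/-- If the double graph percolates, then at some point of a slowed-down process there is a cluster
of medium size. -/
lemma exists_medium_of_percolates [Fintype V] [DecidableEq V] (G : DoubleGraph V)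
    (hG : Percolates G) {k : ℕ} (hk : 2 ≤ k) (hkV : k ≤ Fintype.card V) :
    ∃ S : Finset V, k ≤ S.card ∧ S.card < 2 * k ∧ TreeManyEdges G.red S ∧
      TreeManyEdges G.blue S := by
  by_contra! hno
  obtain ⟨t, ht⟩ := hG
  have : Nonempty V := Fintype.card_pos_iff.1 (by omega)
  obtain ⟨v⟩ := this
  obtain ⟨S, hS, hSk, -⟩ := clusters_small G hk hno t v
  have : S = Finset.univ := Finset.eq_univ_of_forall fun w => (hS w).2 (by rw [ht]; trivial)
  rw [this, Finset.card_univ] at hSk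
  omega

end Rich

/-! ### First moment bound: no percolation below the threshold -/

section Subcritical

variable {V : Type*}

lemma edgeProb_le (p₁ p₂ : unitInterval) (e : Edge V) :
    (edgeProb p₁ p₂ e : ℝ) ≤ if e.1 then (p₁ : ℝ) else p₂ := by
  unfold edgeProb offDiagProb
  split_ifs <;> simp [p₁.2.1, p₂.2.1]

lemma real_all_edges_le [Fintype V] [DecidableEq V] (p₁ p₂ : unitInterval)
    (T₁ T₂ : Finset (Sym2 V)) :
    (bernoulliPi (edgeProb (V := V) p₁ p₂)).real
      {ω | (∀ e ∈ T₁, ω (true, e)) ∧ ∀ e ∈ T₂, ω (false, e)} ≤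
      (p₁ : ℝ) ^ T₁.card * (p₂ : ℝ) ^ T₂.card := by
  have hset : {ω : Edge V → Prop | (∀ e ∈ T₁, ω (true, e)) ∧ ∀ e ∈ T₂, ω (false, e)} =
      {ω | ∀ e ∈ T₁.image (Prod.mk true) ∪ T₂.image (Prod.mk false), ω e} := by
    ext ω
    simp only [Set.mem_ofPred_eq, Finset.mem_union, Finset.mem_image]
    constructor
    · rintro ⟨h₁, h₂⟩ e (⟨a, ha, rfl⟩ | ⟨a, ha, rfl⟩)
      exacts [h₁ a ha, h₂ a ha]
    · exact fun h => ⟨fun e he => h _ (Or.inl ⟨e, he, rfl⟩), fun e he => h _ (Or.inr ⟨e, he, rfl⟩)⟩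
  have hd : Disjoint (T₁.image (Prod.mk true)) (T₂.image (Prod.mk false)) := by
    rw [Finset.disjoint_left]
    simp
  rw [hset, bernoulliPi_forall, Finset.prod_union hd,
    Finset.prod_image fun _ _ _ _ h => (Prod.mk.inj h).2,
    Finset.prod_image fun _ _ _ _ h => (Prod.mk.inj h).2]
  refine mul_le_mul ?_ ?_ (Finset.prod_nonneg fun e _ => (edgeProb p₁ p₂ _).2.1)
    (pow_nonneg p₁.2.1 _)
  · refine (Finset.prod_le_prod (fun e _ => (edgeProb p₁ p₂ _).2.1) fun e _ =>
      edgeProb_le p₁ p₂ (true, e)).trans ?_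
    simp
  · refine (Finset.prod_le_prod (fun e _ => (edgeProb p₁ p₂ _).2.1) fun e _ =>
      edgeProb_le p₁ p₂ (false, e)).trans ?_
    simp

/-- Union bound over the two edge sets of size `|S| - 1`. Forgetting that they form trees leaves a
plain binomial count, and `S.sym2` contains the diagonal, whence `|S| + 1` instead of `|S|`. -/
lemma real_treeManyEdges_le [Fintype V] [DecidableEq V] (p₁ p₂ : unitInterval) (S : Finset V) :
    (bernoulliPi (edgeProb (V := V) p₁ p₂)).real
      {ω | TreeManyEdges (toDouble ω).red S ∧ TreeManyEdges (toDouble ω).blue S} ≤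
      (((S.card + 1).choose 2).choose (S.card - 1) : ℝ) ^ 2 *
        ((p₁ : ℝ) * p₂) ^ (S.card - 1) := by
  set N := S.sym2.powersetCard (S.card - 1) with hN
  have hsub : {ω : Edge V → Prop | TreeManyEdges (toDouble ω).red S ∧
      TreeManyEdges (toDouble ω).blue S} ⊆ ⋃ T ∈ N ×ˢ N,
      {ω : Edge V → Prop | (∀ e ∈ T.1, ω (true, e)) ∧ ∀ e ∈ T.2, ω (false, e)} := by
    rintro ω ⟨⟨T₁, hc₁, hT₁⟩, ⟨T₂, hc₂, hT₂⟩⟩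
    refine Set.mem_biUnion (x := (T₁, T₂)) ?_ ⟨fun e he => ?_, fun e he => ?_⟩
    · simp only [Finset.coe_product, Set.mem_prod, Finset.mem_coe, hN, Finset.mem_powersetCard]
      exact ⟨⟨fun e he => Finset.mem_sym2_iff.2 (hT₁ e he).2, by omega⟩,
        ⟨fun e he => Finset.mem_sym2_iff.2 (hT₂ e he).2, by omega⟩⟩
    · have := (hT₁ e he).1
      simp only [toDouble, SimpleGraph.edgeSet_fromEdgeSet] at this
      exact this.1
    · have := (hT₂ e he).1
      simp only [toDouble, SimpleGraph.edgeSet_fromEdgeSet] at this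
      exact this.1
  refine (real_mono _ hsub).trans ((measureReal_biUnion_finset_le _ _).trans ?_)
  have hterm : ∀ T ∈ N ×ˢ N, (bernoulliPi (edgeProb (V := V) p₁ p₂)).real
      {ω : Edge V → Prop | (∀ e ∈ T.1, ω (true, e)) ∧ ∀ e ∈ T.2, ω (false, e)} ≤
      ((p₁ : ℝ) * p₂) ^ (S.card - 1) := by
    rintro ⟨T₁, T₂⟩ hT
    simp only [Finset.mem_product, hN, Finset.mem_powersetCard] at hT
    rw [mul_pow]
    have := real_all_edges_le p₁ p₂ T₁ T₂
    rwa [hT.1.2, hT.2.2] at this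
  refine (Finset.sum_le_card_nsmul _ _ _ hterm).trans (le_of_eq ?_)
  rw [Finset.card_product, hN, Finset.card_powersetCard, Finset.card_sym2, nsmul_eq_mul]
  push_cast
  ring

lemma percolationProb_le_sum (n : ℕ) (p₁ p₂ : unitInterval) {k : ℕ} (hk : 2 ≤ k) (hkn : k ≤ n) :
    percolationProb n p₁ p₂ ≤ ∑ l ∈ Finset.Ico k (2 * k),
      (n.choose l : ℝ) * ((((l + 1).choose 2).choose (l - 1) : ℝ) ^ 2 *
        ((p₁ : ℝ) * p₂) ^ (l - 1)) := by
  rw [percolationProb_eq]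
  have hsub : {ω : Edge (Fin n) → Prop | Percolates (toDouble ω)} ⊆
      ⋃ l ∈ Finset.Ico k (2 * k), ⋃ S ∈ (Finset.univ : Finset (Fin n)).powersetCard l,
        {ω | TreeManyEdges (toDouble ω).red S ∧ TreeManyEdges (toDouble ω).blue S} := by
    intro ω hω
    obtain ⟨S, h₁, h₂, hr, hb⟩ := exists_medium_of_percolates (toDouble ω) hω hk (by simpa using hkn)
    simp only [Set.mem_iUnion]
    exact ⟨S.card, Finset.mem_Ico.2 ⟨h₁, h₂⟩, S,
      Finset.mem_powersetCard.2 ⟨Finset.subset_univ _, rfl⟩, hr, hb⟩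
  refine (real_mono _ hsub).trans ((measureReal_biUnion_finset_le _ _).trans ?_)
  refine Finset.sum_le_sum fun l _ => (measureReal_biUnion_finset_le _ _).trans ?_
  have hterm : ∀ S ∈ (Finset.univ : Finset (Fin n)).powersetCard l,
      (bernoulliPi (edgeProb (V := Fin n) p₁ p₂)).real
        {ω | TreeManyEdges (toDouble ω).red S ∧ TreeManyEdges (toDouble ω).blue S} ≤
      (((l + 1).choose 2).choose (l - 1) : ℝ) ^ 2 * ((p₁ : ℝ) * p₂) ^ (l - 1) := by
    intro S hS
    obtain rfl := (Finset.mem_powersetCard.1 hS).2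
    exact real_treeManyEdges_le p₁ p₂ S
  refine (Finset.sum_le_card_nsmul _ _ _ hterm).trans (le_of_eq ?_)
  rw [Finset.card_powersetCard, Finset.card_univ, Fintype.card_fin, nsmul_eq_mul]

/-- Both binomials are estimated by `N ^ i / i!`, and `(j+1)! ≥ ((j+1)/e)^(j+1)`. The squared factor
gives about `(j+1)^(2j)`, half of which cancels against the `(j+1)!` from choosing the vertices;
this leaves one factor `j + 1`, of order `log n`, per edge pair. -/
lemma choose_mul_choose_sq_le (n j : ℕ) :
    (n.choose (j + 1) : ℝ) * (((j + 2).choose 2).choose j : ℝ) ^ 2 ≤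
      n * Real.exp 3 * (n * (j + 1) * Real.exp 3) ^ j := by
  have hf : ((j : ℝ) + 1) ^ (j + 1) ≤ Real.exp 1 ^ (j + 1) * (j + 1).factorial := by
    have := Real.pow_div_factorial_le_exp ((j : ℝ) + 1) (by positivity) (j + 1)
    rw [div_le_iff₀ (by positivity)] at this
    rw [← Real.exp_nat_mul]
    simpa using this
  have h1 : (n.choose (j + 1) : ℝ) * (j + 1) ^ (j + 1) ≤ n ^ (j + 1) * Real.exp 1 ^ (j + 1) := by
    have := Nat.choose_le_pow_div (α := ℝ) (j + 1) n
    rw [le_div_iff₀ (by positivity)] at this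
    calc _ ≤ (n.choose (j + 1) : ℝ) * (Real.exp 1 ^ (j + 1) * (j + 1).factorial) := by gcongr
      _ = (n.choose (j + 1) * (j + 1).factorial) * Real.exp 1 ^ (j + 1) := by ring
      _ ≤ _ := by gcongr
  have h2 : (((j + 2).choose 2).choose j : ℝ) ≤ (j + 1) ^ j * Real.exp 1 ^ (j + 1) := by
    have hm : (((j + 2).choose 2 : ℕ) : ℝ) ≤ (j + 1) ^ 2 := by
      rw [Nat.cast_choose_two]
      push_cast
      nlinarith [(Nat.cast_nonneg j : (0 : ℝ) ≤ j)]
    have := Nat.choose_le_pow_div (α := ℝ) j ((j + 2).choose 2)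
    rw [le_div_iff₀ (by positivity)] at this
    have h3 : (((j + 2).choose 2).choose j : ℝ) * (j + 1) ^ (j + 1) ≤
        ((j + 1) ^ j * Real.exp 1 ^ (j + 1)) * (j + 1) ^ (j + 1) := by
      calc _ ≤ (((j + 2).choose 2).choose j : ℝ) *
            (Real.exp 1 ^ (j + 1) * (j + 1).factorial) := by gcongr
        _ = ((((j + 2).choose 2).choose j : ℝ) * j.factorial) * (j + 1) *
            Real.exp 1 ^ (j + 1) := by
            rw [Nat.factorial_succ]; push_cast; ring
        _ ≤ ((j + 1) ^ 2) ^ j * (j + 1) * Real.exp 1 ^ (j + 1) := by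
            gcongr
            exact this.trans (by gcongr)
        _ = _ := by rw [← pow_mul]; ring
    exact le_of_mul_le_mul_right h3 (by positivity)
  have h4 : ((n.choose (j + 1) : ℝ) * (((j + 2).choose 2).choose j : ℝ) ^ 2) * (j + 1) ^ (j + 1) ≤
      (n * Real.exp 3 * (n * (j + 1) * Real.exp 3) ^ j) * (j + 1) ^ (j + 1) := by
    have he : Real.exp 3 = Real.exp 1 ^ 3 := by rw [← Real.exp_nat_mul]; norm_num
    calc _ = ((n.choose (j + 1) : ℝ) * (j + 1) ^ (j + 1)) *
          (((j + 2).choose 2).choose j : ℝ) ^ 2 := by ring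
      _ ≤ (n ^ (j + 1) * Real.exp 1 ^ (j + 1)) * ((j + 1) ^ j * Real.exp 1 ^ (j + 1)) ^ 2 := by
          gcongr
      _ = (n * Real.exp 3 * (n * (j + 1) * Real.exp 3) ^ j) * (j + 1) ^ j := by
          rw [he, mul_pow ((n : ℝ) * (j + 1)), mul_pow (n : ℝ)]; ring
      _ ≤ _ := by
          gcongr
          · linarith [(Nat.cast_nonneg j : (0 : ℝ) ≤ j)]
          · omega
  exact le_of_mul_le_mul_right h4 (by positivity)

lemma percolationProb_le_of_small {n : ℕ} {p₁ p₂ : unitInterval} {c : ℝ} (hc : 1000 ≤ c)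
    (hn : 100 ≤ n) (h : (p₁ : ℝ) * p₂ ≤ 1 / (c * n * Real.log n)) :
    percolationProb n p₁ p₂ ≤ 2 * Real.exp 3 * Real.log n / n := by
  set ℓ := Real.log n with hℓ
  have hn' : (100 : ℝ) ≤ n := by exact_mod_cast hn
  have hn0 : (0 : ℝ) < n := by linarith
  have hexp : Real.exp ℓ = n := Real.exp_log hn0
  have he1 : Real.exp 1 < 2.7182818286 := Real.exp_one_lt_d9
  have hℓ4 : 4 ≤ ℓ := by
    rw [hℓ, Real.le_log_iff_exp_le hn0]
    have : Real.exp 4 = Real.exp 1 ^ 4 := by rw [← Real.exp_nat_mul]; norm_num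
    rw [this]
    calc Real.exp 1 ^ 4 ≤ 2.7182818286 ^ 4 := by gcongr
      _ ≤ 100 := by norm_num
      _ ≤ n := hn'
  have hℓn : ℓ ≤ n / 4 + 2 := by
    have h1 := Real.log_le_sub_one_of_pos (show (0 : ℝ) < n / 4 by positivity)
    have h2 := Real.log_le_sub_one_of_pos (show (0 : ℝ) < 4 by norm_num)
    rw [Real.log_div hn0.ne' (by norm_num)] at h1
    linarith
  -- The window starts at `⌈ℓ⌉₊ + 1`, so that the exponent `j = l - 1` is at least `ℓ = log n` for
  -- every size `l` in it.
  have hk1 := Nat.le_ceil ℓ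
  have hk2 := Nat.ceil_lt_add_one (show 0 ≤ ℓ by linarith)
  have hkn : ⌈ℓ⌉₊ + 1 ≤ n := by
    have : ((⌈ℓ⌉₊ + 1 : ℕ) : ℝ) ≤ n := by push_cast; linarith
    exact_mod_cast this
  have hk : 2 ≤ ⌈ℓ⌉₊ + 1 := by
    have : 0 < ⌈ℓ⌉₊ := Nat.ceil_pos.2 (by linarith)
    omega
  refine (percolationProb_le_sum n p₁ p₂ hk hkn).trans ?_
  have hterm : ∀ l ∈ Finset.Ico (⌈ℓ⌉₊ + 1) (2 * (⌈ℓ⌉₊ + 1)),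
      (n.choose l : ℝ) * ((((l + 1).choose 2).choose (l - 1) : ℝ) ^ 2 *
        ((p₁ : ℝ) * p₂) ^ (l - 1)) ≤ Real.exp 3 / n := by
    intro l hl
    obtain ⟨hl1, hl2⟩ := Finset.mem_Ico.1 hl
    obtain ⟨j, rfl⟩ : ∃ j, l = j + 1 := ⟨l - 1, by omega⟩
    have hj1 : ℓ ≤ j := hk1.trans (by exact_mod_cast (by omega : ⌈ℓ⌉₊ ≤ j))
    have hj2 : (j : ℝ) + 1 ≤ 4 * ℓ := by
      have : ((j + 1 : ℕ) : ℝ) ≤ ((2 * ⌈ℓ⌉₊ + 1 : ℕ) : ℝ) := by exact_mod_cast (by omega)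
      push_cast at this
      linarith
    have hp0 : 0 ≤ (p₁ : ℝ) * p₂ := mul_nonneg p₁.2.1 p₂.2.1
    -- The constant `1000 = 4 * 250` comes from `j + 1 ≤ 4ℓ` and `e⁵ ≤ 250`. A base of `e⁻²` makes
    -- the `j`-th power at most `n⁻²`, which beats the prefactor `n`.
    have hbase : n * (j + 1) * Real.exp 3 * ((p₁ : ℝ) * p₂) ≤ Real.exp (-2) := by
      have h5 : Real.exp 3 * Real.exp 2 ≤ 250 := by
        rw [← Real.exp_add]
        have : Real.exp (3 + 2) = Real.exp 1 ^ 5 := by rw [← Real.exp_nat_mul]; norm_num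
        rw [this]
        calc Real.exp 1 ^ 5 ≤ 2.7182818286 ^ 5 := by gcongr
          _ ≤ 250 := by norm_num
      rw [Real.exp_neg, ← one_div, le_div_iff₀ (Real.exp_pos 2)]
      calc n * (j + 1) * Real.exp 3 * ((p₁ : ℝ) * p₂) * Real.exp 2
          = n * (j + 1) * (Real.exp 3 * Real.exp 2) * ((p₁ : ℝ) * p₂) := by ring
        _ ≤ n * (4 * ℓ) * 250 * (1 / (c * n * ℓ)) := by gcongr
        _ = 1000 / c := by field_simp; norm_num
        _ ≤ 1 := by rw [div_le_one (by linarith)]; exact hc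
    calc (n.choose (j + 1) : ℝ) * ((((j + 1 + 1).choose 2).choose (j + 1 - 1) : ℝ) ^ 2 *
          ((p₁ : ℝ) * p₂) ^ (j + 1 - 1))
        = ((n.choose (j + 1) : ℝ) * (((j + 2).choose 2).choose j : ℝ) ^ 2) *
          ((p₁ : ℝ) * p₂) ^ j := by rw [Nat.add_sub_cancel]; ring
      _ ≤ (n * Real.exp 3 * (n * (j + 1) * Real.exp 3) ^ j) * ((p₁ : ℝ) * p₂) ^ j := by
          exact mul_le_mul_of_nonneg_right (choose_mul_choose_sq_le n j) (pow_nonneg hp0 j)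
      _ = n * Real.exp 3 * (n * (j + 1) * Real.exp 3 * ((p₁ : ℝ) * p₂)) ^ j := by
          rw [mul_pow _ ((p₁ : ℝ) * p₂)]; ring
      _ ≤ n * Real.exp 3 * Real.exp (-2) ^ j := by gcongr
      _ ≤ n * Real.exp 3 * Real.exp (-(2 * ℓ)) := by
          rw [← Real.exp_nat_mul]
          gcongr
          linarith
      _ = Real.exp 3 / n := by
          rw [Real.exp_neg, two_mul, Real.exp_add, hexp]
          field_simp
  refine (Finset.sum_le_card_nsmul _ _ _ hterm).trans ?_
  rw [Nat.card_Ico, nsmul_eq_mul, two_mul, Nat.add_sub_cancel]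
  push_cast
  calc ((⌈ℓ⌉₊ : ℝ) + 1) * (Real.exp 3 / n) ≤ (2 * ℓ) * (Real.exp 3 / n) := by
        gcongr
        linarith
    _ = _ := by ring

lemma tendsto_percolationProb_zero {c : ℝ} (hc : 1000 ≤ c) (p₁ p₂ : ℕ → unitInterval)
    (h : ∀ᶠ n : ℕ in atTop, (p₁ n : ℝ) * (p₂ n : ℝ) ≤ 1 / (c * n * Real.log n)) :
    Tendsto (fun n : ℕ => percolationProb n (p₁ n) (p₂ n)) atTop (𝓝 0) := by
  have hlim : Tendsto (fun n : ℕ => 2 * Real.exp 3 * Real.log n / n) atTop (𝓝 0) := by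
    have := (Real.isLittleO_log_id_atTop.tendsto_div_nhds_zero.comp
      tendsto_natCast_atTop_atTop).const_mul (2 * Real.exp 3)
    simpa [Function.comp_def, mul_div_assoc] using this
  refine tendsto_of_tendsto_of_tendsto_of_le_of_le' tendsto_const_nhds hlim
    (Eventually.of_forall fun n => measureReal_nonneg) ?_
  filter_upwards [h, eventually_ge_atTop 100] with n hn hn'
  exact percolationProb_le_of_small hc hn' hn

end Subcritical

/-! ### Growth by single vertices, and the edges on which it depends -/

section Grows

variable {V : Type*} [DecidableEq V]

/-- `Y` is obtained from `X` by adding vertices one at a time, each of which is joined to the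
current set by a red and by a blue edge. -/
inductive Grows (ω : Edge V → Prop) (X : Finset V) : Finset V → Prop
  | refl : Grows ω X X
  | insert {Y : Finset V} {v : V} : Grows ω X Y → v ∉ Y → (∃ u ∈ Y, ω (true, s(u, v))) →
      (∃ u ∈ Y, ω (false, s(u, v))) → Grows ω X (insert v Y)

lemma Grows.subset {ω : Edge V → Prop} {X Y : Finset V} (h : Grows ω X Y) : X ⊆ Y := by
  induction h with
  | refl => exact subset_rfl
  | insert _ _ _ _ ih => exact ih.trans (Finset.subset_insert _ _)

lemma Grows.mono {ω ω' : Edge V → Prop} (hω : ∀ e, ω e → ω' e) {X Y : Finset V}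
    (h : Grows ω X Y) : Grows ω' X Y := by
  induction h with
  | refl => exact .refl
  | insert _ hv hr hb ih =>
    exact ih.insert hv (hr.imp fun u hu => ⟨hu.1, hω _ hu.2⟩) (hb.imp fun u hu => ⟨hu.1, hω _ hu.2⟩)

lemma Grows.trans {ω : Edge V → Prop} {X Y Z : Finset V} (h : Grows ω X Y) (h' : Grows ω Y Z) :
    Grows ω X Z := by
  induction h' with
  | refl => exact h
  | insert _ hv hr hb ih => exact ih.insert hv hr hb

/-- All vertices of `R` that are joined to `X` in both colours may be added to `X`. -/
lemma Grows.union {ω : Edge V → Prop} {X R : Finset V}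
    (hR : ∀ v ∈ R, ∀ c, ∃ u ∈ X, ω (c, s(u, v))) : Grows ω X (X ∪ R) := by
  induction R using Finset.induction_on with
  | empty => simpa using Grows.refl
  | insert v R hv ih =>
    have ih' := ih fun w hw => hR w (Finset.mem_insert_of_mem hw)
    rw [Finset.union_insert]
    by_cases hvX : v ∈ X ∪ R
    · rwa [Finset.insert_eq_of_mem hvX]
    · have := hR v (Finset.mem_insert_self _ _)
      exact ih'.insert hvX
        ((this true).imp fun u hu => ⟨Finset.mem_union_left _ hu.1, hu.2⟩)
        ((this false).imp fun u hu => ⟨Finset.mem_union_left _ hu.1, hu.2⟩)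

/-- The edges of `ω` that belong to `S`. -/
def restrict (S : Set (Edge V)) (ω : Edge V → Prop) : Edge V → Prop := fun e => e ∈ S ∧ ω e

omit [DecidableEq V] in
lemma restrict_congr {S : Set (Edge V)} {x y : Edge V → Prop} (h : ∀ e ∈ S, x e = y e) :
    restrict S x = restrict S y := by
  funext e
  by_cases he : e ∈ S
  · simp [restrict, he, h e he]
  · simp [restrict, he]

omit [DecidableEq V] in
lemma dependsOn_restrict {α : Type*} {S : Set (Edge V)} (f : (Edge V → Prop) → α) :
    DependsOn (fun ω => f (restrict S ω)) S := fun _ _ h => by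
  change f _ = f _
  rw [restrict_congr h]

/-- The edges of both colours with both ends in `U`. -/
def inside (U : Finset V) : Set (Edge V) := {e | ∀ v ∈ e.2, v ∈ U}

/-- The edges of colour `c` between `X` and `Y`. -/
def between (c : Bool) (X Y : Finset V) : Set (Edge V) :=
  {e | e.1 = c ∧ ∃ u ∈ X, ∃ v ∈ Y, e.2 = s(u, v)}

omit [DecidableEq V] in
lemma inside_mono {U W : Finset V} (h : U ⊆ W) : inside U ⊆ inside W :=
  fun _ he v hv => h (he v hv)

omit [DecidableEq V] in
lemma between_mono {c : Bool} {X X' Y Y' : Finset V} (hX : X ⊆ X') (hY : Y ⊆ Y') :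
    between c X Y ⊆ between c X' Y' := by
  rintro e ⟨hc, u, hu, v, hv, he⟩
  exact ⟨hc, u, hX hu, v, hY hv, he⟩

omit [DecidableEq V] in
lemma between_subset_inside {c : Bool} {X Y U : Finset V} (hX : X ⊆ U) (hY : Y ⊆ U) :
    between c X Y ⊆ inside U := by
  rintro ⟨_, e⟩ ⟨_, u, hu, v, hv, rfl⟩ w hw
  rcases Sym2.mem_iff.1 hw with rfl | rfl
  exacts [hX hu, hY hv]

omit [DecidableEq V] in
lemma disjoint_between_inside {c : Bool} {X Y U : Finset V} (h : Disjoint X U) :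
    Disjoint (between c X Y) (inside U) := by
  rw [Set.disjoint_left]
  rintro ⟨_, e⟩ ⟨_, u, hu, v, hv, rfl⟩ hin
  exact Finset.disjoint_left.1 h hu (hin u (Sym2.mem_mk_left u v))

omit [DecidableEq V] in
lemma between_comm (c : Bool) (X Y : Finset V) : between c X Y = between c Y X := by
  ext ⟨b, e⟩
  constructor
  · rintro ⟨hc, u, hu, v, hv, he⟩
    exact ⟨hc, v, hv, u, hu, he.trans Sym2.eq_swap⟩
  · rintro ⟨hc, u, hu, v, hv, he⟩
    exact ⟨hc, v, hv, u, hu, he.trans Sym2.eq_swap⟩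

omit [DecidableEq V] in
lemma disjoint_between_color {X Y X' Y' : Finset V} {c c' : Bool} (h : c ≠ c') :
    Disjoint (between c X Y) (between c' X' Y') := by
  rw [Set.disjoint_left]
  rintro e ⟨hc, -⟩ ⟨hc', -⟩
  exact h (hc.symm.trans hc')

omit [DecidableEq V] in
/-- Two sets of edges between sets of vertices are disjoint if one end of an edge distinguishes
them. -/
lemma disjoint_between {X Y X' Y' : Finset V} {c c' : Bool} (h₁ : Disjoint Y X')
    (h₂ : Disjoint Y Y') : Disjoint (between c X Y) (between c' X' Y') := by
  rw [Set.disjoint_left]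
  rintro ⟨_, e⟩ ⟨_, u, hu, v, hv, rfl⟩ ⟨_, u', hu', v', hv', he⟩
  rcases Sym2.eq_iff.1 he with ⟨_, rfl⟩ | ⟨_, rfl⟩
  · exact Finset.disjoint_left.1 h₂ hv hv'
  · exact Finset.disjoint_left.1 h₁ hv hu'

lemma Grows.subset_of_restrict {ω : Edge V → Prop} {U X Y : Finset V}
    (h : Grows (restrict (inside U) ω) X Y) (hX : X ⊆ U) : Y ⊆ U := by
  induction h with
  | refl => exact hX
  | insert _ _ hr _ ih =>
    obtain ⟨u, hu, hin, -⟩ := hr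
    exact Finset.insert_subset (hin _ (Sym2.mem_mk_right _ _)) ih

/-- A set grown from a single vertex lies in one cluster. -/
lemma Grows.exists_partitionAt {ω : Edge V → Prop} {x : V} {Y : Finset V} (h : Grows ω {x} Y) :
    ∃ t, ∀ v ∈ Y, partitionAt (toDouble ω) t x v := by
  have hstep : ∀ t u v, partitionAt (toDouble ω) t u v → partitionAt (toDouble ω) (t + 1) u v := by
    intro t u v h
    change (clusterGraph _ _).Reachable _ _
    rw [show Quotient.mk (partitionAt (toDouble ω) t) u = Quotient.mk _ v from Quotient.sound h]
  induction h with
  | refl => exact ⟨0, fun v hv => by rw [Finset.mem_singleton.1 hv]⟩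
  | @insert Y v _ hv hr hb ih =>
    obtain ⟨t, ht⟩ := ih
    refine ⟨t + 1, fun w hw => ?_⟩
    rcases Finset.mem_insert.1 hw with rfl | hw
    · set C := partitionAt (toDouble ω) t with hC
      -- All of `Y` lies in the cluster of `x`, so if `w` is not there yet, its cluster is adjacent
      -- to that of `x` and joins it in one step.
      by_cases hx : C x w
      · exact hstep t x w hx
      · obtain ⟨u, hu, hur⟩ := hr
        obtain ⟨u', hu', hub⟩ := hb
        change (clusterGraph _ _).Reachable _ _
        refine SimpleGraph.Adj.reachable ⟨fun h => hx (Quotient.exact h), ⟨u, w, ?_, rfl, ?_⟩,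
          ⟨u', w, ?_, rfl, ?_⟩⟩
        · exact Quotient.sound (C.symm (ht u hu))
        · exact (SimpleGraph.fromEdgeSet_adj _).2 ⟨hur, by rintro rfl; exact hv hu⟩
        · exact Quotient.sound (C.symm (ht u' hu'))
        · exact (SimpleGraph.fromEdgeSet_adj _).2 ⟨hub, by rintro rfl; exact hv hu'⟩
    · exact hstep t x w (ht w hw)

lemma percolates_of_grows_univ [Fintype V] {ω : Edge V → Prop} {x : V}
    (h : Grows ω {x} Finset.univ) : Percolates (toDouble ω) := by
  obtain ⟨t, ht⟩ := h.exists_partitionAt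
  refine ⟨t, top_unique fun u v _ => ?_⟩
  exact (partitionAt (toDouble ω) t).trans
    ((partitionAt (toDouble ω) t).symm (ht u (Finset.mem_univ u))) (ht v (Finset.mem_univ v))

/-- No set of at least `k` vertices grows from a single vertex by edges inside `U`. -/
def noGrown (k : ℕ) (U : Finset V) : Set (Edge V → Prop) :=
  {ω | ¬ ∃ x ∈ U, ∃ Y, k ≤ Y.card ∧ Grows (restrict (inside U) ω) {x} Y}

lemma dependsOn_noGrown (k : ℕ) (U : Finset V) :
    DependsOn (fun ω => ω ∈ noGrown k U) (inside U) :=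
  dependsOn_restrict fun ω => ¬ ∃ x ∈ U, ∃ Y : Finset V, k ≤ Y.card ∧ Grows ω {x} Y

lemma noGrown_anti (k : ℕ) {U W : Finset V} (h : U ⊆ W) : noGrown k W ⊆ noGrown k U := by
  rintro ω hω ⟨x, hx, Y, hk, hY⟩
  exact hω ⟨x, h hx, Y, hk, hY.mono fun e he => ⟨inside_mono h he.1, he.2⟩⟩

/-- Some vertex of `X` is joined to `v` in colour `c`. -/
def joined (c : Bool) (X : Finset V) (v : V) : Set (Edge V → Prop) :=
  {ω | ∃ u ∈ X, ω (c, s(u, v))}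

omit [DecidableEq V] in
lemma dependsOn_joined (c : Bool) (X : Finset V) (v : V) :
    DependsOn (fun ω => ω ∈ joined c X v) (between c X {v}) := by
  intro x y h
  simp only [joined, Set.mem_ofPred_eq, eq_iff_iff]
  exact exists_congr fun u => and_congr_right fun hu => by
    rw [h _ ⟨rfl, u, hu, v, by simp, rfl⟩]

lemma real_edges_absent [Fintype V] (p₁ p₂ : unitInterval) (c : Bool) (X Y : Finset V)
    (h : Disjoint X Y) :
    (bernoulliPi (edgeProb (V := V) p₁ p₂)).real {ω | ∀ u ∈ X, ∀ v ∈ Y, ¬ ω (c, s(u, v))} =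
      (1 - ((if c then p₁ else p₂ : unitInterval) : ℝ)) ^ (X.card * Y.card) := by
  have hset : {ω : Edge V → Prop | ∀ u ∈ X, ∀ v ∈ Y, ¬ ω (c, s(u, v))} =
      {ω | ∀ e ∈ (X ×ˢ Y).image (fun z => (c, s(z.1, z.2))), ¬ ω e} := by
    ext ω
    simp only [Set.mem_ofPred_eq, Finset.mem_image, Finset.mem_product]
    constructor
    · rintro h e ⟨⟨u, v⟩, ⟨hu, hv⟩, rfl⟩
      exact h u hu v hv
    · exact fun h u hu v hv => h _ ⟨(u, v), ⟨hu, hv⟩, rfl⟩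
  -- Disjointness of `X` and `Y` rules out counting a pair in both orders, and keeps the edges off
  -- the diagonal.
  have hinj : Set.InjOn (fun z : V × V => (c, s(z.1, z.2))) (X ×ˢ Y : Finset (V × V)) := by
    rintro ⟨u, v⟩ huv ⟨u', v'⟩ huv' he
    simp only [Finset.coe_product, Set.mem_prod, Finset.mem_coe] at huv huv'
    rcases Sym2.eq_iff.1 (Prod.mk.inj he).2 with ⟨h₁, h₂⟩ | ⟨h₁, h₂⟩
    · exact Prod.ext h₁ h₂
    · exact absurd huv'.2 (Finset.disjoint_left.1 h ((show u = v' from h₁) ▸ huv.1))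
  rw [hset, bernoulliPi_forall_not, Finset.prod_image hinj, ← Finset.card_product]
  refine Finset.prod_eq_pow_card fun z hz => ?_
  have hne : z.1 ≠ z.2 := fun heq =>
    Finset.disjoint_left.1 h (Finset.mem_product.1 hz).1 (heq ▸ (Finset.mem_product.1 hz).2)
  simp [edgeProb, offDiagProb, hne]

lemma real_joined [Fintype V] (p₁ p₂ : unitInterval) (c : Bool) (X : Finset V) (v : V)
    (h : v ∉ X) :
    (bernoulliPi (edgeProb (V := V) p₁ p₂)).real (joined c X v) =
      1 - (1 - ((if c then p₁ else p₂ : unitInterval) : ℝ)) ^ X.card := by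
  have : joined c X v = {ω : Edge V → Prop | ∀ u ∈ X, ∀ w ∈ ({v} : Finset V), ¬ ω (c, s(u, w))}ᶜ := by
    ext ω
    simp [joined]
  rw [this, real_compl, real_edges_absent _ _ _ _ _ (by simpa using h)]
  simp

end Grows

/-! ### Exploring a random set and continuing from one of its elements -/

section Pick

open Classical in
/-- An element of a set, if there is one. -/
noncomputable def pick {α : Type*} (s : Set α) : Option α :=
  if h : s.Nonempty then some h.some else none

lemma mem_of_pick_eq_some {α : Type*} {s : Set α} {t : α} (h : pick s = some t) : t ∈ s := by
  unfold pick at h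
  split_ifs at h with hs
  rw [← Option.some.inj h]
  exact hs.some_mem

lemma pick_eq_none {α : Type*} {s : Set α} : pick s = none ↔ s = ∅ := by
  unfold pick
  split_ifs with hs
  · simpa using hs.ne_empty
  · simpa [Set.not_nonempty_iff_eq_empty] using hs

variable {E : Type*}

lemma dependsOn_inter {A B : Set (E → Prop)} {S T U : Set E}
    (hA : DependsOn (fun ω => ω ∈ A) S) (hB : DependsOn (fun ω => ω ∈ B) T)
    (hS : S ⊆ U) (hT : T ⊆ U) : DependsOn (fun ω => ω ∈ A ∩ B) U := by
  intro x y h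
  exact congrArg₂ And (hA fun i hi => h i (hS hi)) (hB fun i hi => h i (hT hi))

/-- If the random set `s` is empty with probability at most `1 - ρ`, then exploring `s` and
choosing one of its elements bounds the probability of `F` by a convex combination. -/
lemma real_le_of_pick [Fintype E] (p : E → unitInterval) {α : Type*} [Fintype α]
    (s : (E → Prop) → Set α) {S T₀ : Set E} (hs : DependsOn s S)
    (F H₀ : Set (E → Prop)) (H : α → Set (E → Prop)) (T : α → Set E)
    (hH₀ : DependsOn (fun ω => ω ∈ H₀) T₀) (hST₀ : Disjoint S T₀)
    (hH : ∀ t, (∃ ω, t ∈ s ω) → DependsOn (fun ω => ω ∈ H t) (T t) ∧ Disjoint S (T t))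
    (hF₀ : F ⊆ H₀) (hF : ∀ ω ∈ F, ∀ t ∈ s ω, ω ∈ H t) {a b ρ : ℝ}
    (ha : (bernoulliPi p).real H₀ ≤ a)
    (hb : ∀ t, (∃ ω, t ∈ s ω) → (bernoulliPi p).real (H t) ≤ b) (hba : b ≤ a)
    (hρ : (bernoulliPi p).real {ω | s ω = ∅} ≤ 1 - ρ) :
    (bernoulliPi p).real F ≤ (1 - ρ) * a + ρ * b := by
  classical
  -- Values `t` that `s` never takes satisfy no hypothesis, so they receive the empty event and no
  -- edges.
  let H' : Option α → Set (E → Prop) := fun t =>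
    t.elim H₀ fun t => if ∃ ω, t ∈ s ω then H t else ∅
  let T' : Option α → Set E := fun t => t.elim T₀ fun t => if ∃ ω, t ∈ s ω then T t else ∅
  have hmain := real_le_sum_fiber p (fun ω => pick (s ω)) F H' (fun _ => S) T'
    (fun t x y h => by simp only [Set.mem_preimage, hs h]) ?_ ?_ ?_
  · have hnone : (bernoulliPi p).real ((fun ω => pick (s ω)) ⁻¹' {none}) ≤ 1 - ρ := by
      refine le_trans (real_mono p fun ω hω => ?_) hρ
      exact pick_eq_none.1 hω
    have hsum := sum_fiber_real p (fun ω => pick (s ω)) Set.univ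
    simp only [Set.inter_univ, Fintype.sum_option, probReal_univ] at hsum
    rw [Fintype.sum_option] at hmain
    set π := (bernoulliPi p).real ((fun ω => pick (s ω)) ⁻¹' {none})
    have h1 : ∑ t, (bernoulliPi p).real ((fun ω => pick (s ω)) ⁻¹' {some t}) *
        (bernoulliPi p).real (H' (some t)) ≤
        ∑ t, (bernoulliPi p).real ((fun ω => pick (s ω)) ⁻¹' {some t}) * b := by
      refine Finset.sum_le_sum fun t _ => ?_
      by_cases ht : ∃ ω, t ∈ s ω
      · simp only [H', Option.elim_some, if_pos ht]
        exact mul_le_mul_of_nonneg_left (hb t ht) measureReal_nonneg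
      · have : (fun ω => pick (s ω)) ⁻¹' {some t} = ∅ := by
          ext ω
          simp only [Set.mem_preimage, Set.mem_singleton_iff, Set.mem_empty_iff_false, iff_false]
          exact fun h => ht ⟨ω, mem_of_pick_eq_some h⟩
        simp [this]
    rw [← Finset.sum_mul, eq_sub_of_add_eq' hsum.symm] at h1
    -- The total is at most `π * a + (1 - π) * b`, which increases with `π` because `b ≤ a`; then `π
    -- ≤ 1 - ρ` is inserted.
    have h2 : π * (bernoulliPi p).real (H' none) ≤ π * a :=
      mul_le_mul_of_nonneg_left ha measureReal_nonneg
    nlinarith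
  · rintro (_ | t)
    · exact hH₀
    · by_cases ht : ∃ ω, t ∈ s ω
      · simpa only [H', T', Option.elim_some, if_pos ht] using (hH t ht).1
      · simp only [H', T', Option.elim_some, if_neg ht]
        exact fun _ _ _ => rfl
  · rintro (_ | t)
    · exact hST₀
    · by_cases ht : ∃ ω, t ∈ s ω
      · simpa only [T', Option.elim_some, if_pos ht] using (hH t ht).2
      · simp only [T', Option.elim_some, if_neg ht, Set.disjoint_empty]
  · rintro (_ | t) ω hω hωt
    · exact hF₀ hω
    · have hmem := mem_of_pick_eq_some hωt
      have ht : ∃ ω, t ∈ s ω := ⟨ω, hmem⟩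
      simp only [H', Option.elim_some, if_pos ht]
      exact hF ω hω t hmem

end Pick

/-! ### Growing a cluster of logarithmic size from one vertex -/

section Seed

variable {V : Type*} [DecidableEq V]

/-- The edges that are still unexplored when a cluster `X` with the newest vertex `x` has been
grown; `A` is the set of vertices that may be added, and `B` is the set of unused vertices. -/
def unexplored (X : Finset V) (x : V) (A B : Finset V) : Set (Edge V) :=
  between true {x} A ∪ between false X A ∪ inside B

/-- The cluster `X` cannot be grown to size `L` by unexplored edges, and no large set grows inside
`B` either. -/
def seedFail (L : ℕ) (X : Finset V) (x : V) (A B : Finset V) : Set (Edge V → Prop) :=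
  noGrown L B ∩ {ω | ¬ ∃ Y, L ≤ Y.card ∧ Grows (restrict (unexplored X x A B) ω) X Y}

lemma dependsOn_seedFail (L : ℕ) (X : Finset V) (x : V) (A B : Finset V) :
    DependsOn (fun ω => ω ∈ seedFail L X x A B) (unexplored X x A B) :=
  dependsOn_inter (dependsOn_noGrown L B)
    (dependsOn_restrict fun ω => ¬ ∃ Y : Finset V, L ≤ Y.card ∧ Grows ω X Y)
    Set.subset_union_right subset_rfl

/-- The continuation from `v` never looks again at the red edges of the previous newest vertex, so
these may be revealed beforehand. -/
lemma unexplored_subset {X A B R : Finset V} {v : V} (hAB : A ⊆ B) (hv : v ∈ A) :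
    unexplored (insert v X) v (A \ R) (B.erase v) ⊆ between false X A ∪ inside B := by
  have hin : ∀ c, between c {v} (A \ R) ⊆ inside B := fun c =>
    between_subset_inside (by simpa using hAB hv) (Finset.sdiff_subset.trans hAB)
  rintro e ((he | he) | he)
  · exact Or.inr (hin _ he)
  · obtain ⟨hc, u, hu, w, hw, heq⟩ := he
    rcases Finset.mem_insert.1 hu with rfl | hu
    · exact Or.inr (hin _ ⟨hc, u, by simp, w, hw, heq⟩)
    · exact Or.inl ⟨hc, u, hu, w, Finset.sdiff_subset hw, heq⟩
  · exact Or.inr (inside_mono (Finset.erase_subset _ _) he)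

/-- Failure is inherited: `v` can be added to `X` by unexplored edges, so a large set grown from
`insert v X` would also grow from `X`. -/
lemma mem_seedFail_insert {L : ℕ} {X A B R : Finset V} {x v : V} {ω : Edge V → Prop}
    (hω : ω ∈ seedFail L X x A B) (hx : x ∈ X) (hAB : A ⊆ B) (hXB : Disjoint X B) (hv : v ∈ A)
    (hr : ω ∈ joined true {x} v) (hb : ω ∈ joined false X v) :
    ω ∈ seedFail L (insert v X) v (A \ R) (B.erase v) := by
  refine ⟨noGrown_anti L (Finset.erase_subset _ _) hω.1, ?_⟩
  rintro ⟨Y, hLY, hY⟩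
  refine hω.2 ⟨Y, hLY, Grows.trans (Y := insert v X) ?_ (hY.mono ?_)⟩
  · obtain ⟨u, hu, hur⟩ := hr
    obtain ⟨w, hw, hwb⟩ := hb
    obtain rfl := Finset.mem_singleton.1 hu
    exact Grows.refl.insert (fun h => Finset.disjoint_left.1 hXB h (hAB hv))
      ⟨u, hx, Or.inl (Or.inl ⟨rfl, u, by simp, v, hv, rfl⟩), hur⟩
      ⟨w, hw, Or.inl (Or.inr ⟨rfl, w, hw, v, hv, rfl⟩), hwb⟩
  · rintro e ⟨he, h⟩
    refine ⟨?_, h⟩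
    rcases unexplored_subset hAB hv he with he | he
    · exact Or.inl (Or.inr he)
    · exact Or.inr he

/-- Induction on the number `j` of vertices still missing. With probability at least `1/2` the
vertex `x` has `r` red neighbours in `A`, forming `R`; with probability at least `|X|/(2L)` some `v
∈ R` has a blue edge to `X`, and the exploration continues from `v` with `R` discarded. If either
stage fails, the edges inside `B` are still unrevealed, so the failure probability is at most `a`.
Carrying `noGrown L B` inside `seedFail` is what yields the factor `a`, and lets successive attempts
multiply. -/
lemma real_seedFail_le [Fintype V] (p₁ p₂ : unitInterval) {L r M M' : ℕ} {a : ℝ}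
    (hN : ∀ B : Finset V, M ≤ B.card →
      (bernoulliPi (edgeProb (V := V) p₁ p₂)).real (noGrown L B) ≤ a)
    (hr : ∀ (x : V) (A : Finset V), x ∉ A → M' ≤ A.card →
      (bernoulliPi (edgeProb (V := V) p₁ p₂)).real
        {ω | ¬ ∃ R ⊆ A, r ≤ R.card ∧ ∀ v ∈ R, ω ∈ joined true {x} v} ≤ 1 / 2)
    (hb : ∀ k : ℕ, k < L → (k : ℝ) / (2 * L) ≤ 1 - (1 - (p₂ : ℝ)) ^ (k * r))
    (j : ℕ) : ∀ (X : Finset V) (x : V) (A B : Finset V), X.card + j = L → x ∈ X → A ⊆ B →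
      Disjoint X B → M + j ≤ B.card → M' + j * r ≤ A.card →
      (bernoulliPi (edgeProb (V := V) p₁ p₂)).real (seedFail L X x A B) ≤
        (1 - ∏ i ∈ Finset.Ico X.card L, (i : ℝ) / (4 * L)) * a := by
  induction j with
  | zero =>
    intro X x A B hX _ _ _ _ _
    have : seedFail L X x A B = ∅ := by
      ext ω
      simp only [Set.mem_empty_iff_false, iff_false]
      exact fun h => h.2 ⟨X, by omega, .refl⟩
    rw [this, Finset.Ico_eq_empty (by omega)]
    simp
  | succ j ih =>
    intro X x A B hX hx hAB hXB hB hA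
    set μ := bernoulliPi (edgeProb (V := V) p₁ p₂) with hμ
    have hNB : μ.real (noGrown L B) ≤ a := hN B (by omega)
    have ha : 0 ≤ a := measureReal_nonneg.trans hNB
    have hkL : X.card < L := by omega
    have hL : (0 : ℝ) < L := by exact_mod_cast (by omega : 0 < L)
    set Q := ∏ i ∈ Finset.Ico (X.card + 1) L, (i : ℝ) / (4 * L) with hQ
    have hQ0 : 0 ≤ Q := Finset.prod_nonneg fun i _ => by positivity
    have hprod : ∏ i ∈ Finset.Ico X.card L, (i : ℝ) / (4 * L) = X.card / (4 * L) * Q :=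
      Finset.prod_eq_prod_Ico_succ_bot hkL _
    let branch : Finset V → Set (Edge V → Prop) := fun R => noGrown L B ∩
      {ω | ∀ v ∈ R, ω ∈ joined false X v → ω ∈ seedFail L (insert v X) v (A \ R) (B.erase v)}
    have hXR : ∀ R : Finset V, R ⊆ A → Disjoint X R := fun R hR => hXB.mono_right (hR.trans hAB)
    have hbranch : ∀ R : Finset V, R ⊆ A → R.card = r →
        -- Second stage: the blue edges between `X` and `R` are revealed.
        μ.real (branch R) ≤ (1 - X.card / (2 * L)) * a + X.card / (2 * L) * ((1 - Q) * a) := by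
      intro R hRA hRr
      refine real_le_of_pick _ (fun ω => {v | v ∈ R ∧ ω ∈ joined false X v})
        (S := between false X R) (T₀ := inside B) ?_ (branch R) (noGrown L B)
        (fun v => seedFail L (insert v X) v (A \ R) (B.erase v))
        (fun v => unexplored (insert v X) v (A \ R) (B.erase v)) (dependsOn_noGrown L B)
        (disjoint_between_inside hXB) ?_ Set.inter_subset_left ?_ hNB ?_ ?_ ?_
      · intro ω ω' h
        ext v
        refine and_congr_right fun hv => ?_
        refine iff_of_eq (dependsOn_joined false X v fun e he => h e ?_)
        exact between_mono subset_rfl (by simpa using hv) he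
      · rintro v ⟨-, hv, -⟩
        refine ⟨dependsOn_seedFail _ _ _ _ _, ?_⟩
        refine Disjoint.union_right (Disjoint.union_right ?_ ?_) ?_
        · exact disjoint_between_color (by decide)
        · exact (disjoint_between ((hXR _ Finset.sdiff_subset).symm) Finset.sdiff_disjoint).symm
        · exact disjoint_between_inside (hXB.mono_right (Finset.erase_subset _ _))
      · exact fun ω hω v hv => hω.2 v hv.1 hv.2
      · rintro v ⟨-, hv, -⟩
        have hvX : v ∉ X := fun h => Finset.disjoint_left.1 (hXR R hRA) h hv
        have := ih (insert v X) v (A \ R) (B.erase v)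
          (by rw [Finset.card_insert_of_notMem hvX]; omega) (Finset.mem_insert_self _ _)
          (fun w hw => Finset.mem_erase.2 ⟨?_, hAB (Finset.sdiff_subset hw)⟩) ?_ ?_ ?_
        · rwa [Finset.card_insert_of_notMem hvX] at this
        · rintro rfl
          exact (Finset.mem_sdiff.1 hw).2 hv
        · rw [Finset.disjoint_insert_left]
          exact ⟨Finset.notMem_erase v B, hXB.mono_right (Finset.erase_subset _ _)⟩
        · rw [Finset.card_erase_of_mem (hAB (hRA hv))]
          omega
        · rw [Finset.card_sdiff_of_subset hRA, hRr]
          rw [add_mul] at hA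
          omega
      · nlinarith
      · have hset : {ω : Edge V → Prop | {v | v ∈ R ∧ ω ∈ joined false X v} = ∅} =
            {ω | ∀ u ∈ X, ∀ v ∈ R, ¬ ω (false, s(u, v))} := by
          ext ω
          simp only [Set.mem_ofPred_eq, Set.eq_empty_iff_forall_notMem, joined, not_and, not_exists]
          exact ⟨fun h u hu v hv => h v hv u hu, fun h v hv u hu => h u hu v hv⟩
        rw [hset, real_edges_absent _ _ _ _ _ (hXR R hRA), hRr]
        have := hb X.card hkL
        simp only [Bool.false_eq_true, if_false]
        linarith
    -- First stage: the red edges from `x` to `A` are revealed, and a set `R` of exactly `r`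
    -- neighbours is chosen.
    have hmain : μ.real (seedFail L X x A B) ≤ (1 - 1 / 2) * a +
        1 / 2 * ((1 - X.card / (2 * L)) * a + X.card / (2 * L) * ((1 - Q) * a)) := by
      refine real_le_of_pick _
        (fun ω => {R : Finset V | R ⊆ A ∧ R.card = r ∧ ∀ v ∈ R, ω ∈ joined true {x} v})
        (S := between true {x} A) (T₀ := inside B) ?_ _ (noGrown L B) branch
        (fun _ => between false X A ∪ inside B) (dependsOn_noGrown L B)
        (disjoint_between_inside (by simpa using Finset.disjoint_left.1 hXB hx)) ?_
        Set.inter_subset_left ?_ hNB ?_ ?_ ?_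
      · intro ω ω' h
        ext R
        refine and_congr_right fun hR => and_congr_right fun _ => forall₂_congr fun v hv => ?_
        refine iff_of_eq (dependsOn_joined true {x} v fun e he => h e ?_)
        exact between_mono subset_rfl (by simpa using hR hv) he
      · rintro R ⟨-, hRA, hRr, -⟩
        refine ⟨dependsOn_inter (dependsOn_noGrown L B) (T := between false X A ∪ inside B) ?_
          Set.subset_union_right subset_rfl, ?_⟩
        · intro ω ω' h
          refine propext (forall₂_congr fun v hv => ?_)
          refine imp_congr (iff_of_eq (dependsOn_joined false X v fun e he => h e ?_))
            (iff_of_eq (dependsOn_seedFail _ _ _ _ _ fun e he => h e ?_))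
          · exact Or.inl (between_mono subset_rfl (by simpa using hRA hv) he)
          · exact unexplored_subset hAB (hRA hv) he
        · exact Disjoint.union_right (disjoint_between_color (by decide))
            (disjoint_between_inside (by simpa using Finset.disjoint_left.1 hXB hx))
      · rintro ω hω R ⟨hRA, -, hRj⟩
        exact ⟨hω.1, fun v hv hbl =>
          mem_seedFail_insert hω hx hAB hXB (hRA hv) (hRj v hv) hbl⟩
      · rintro R ⟨-, hRA, hRr, -⟩
        exact hbranch R hRA hRr
      · have : (0 : ℝ) ≤ X.card / (2 * L) * (Q * a) := by positivity
        nlinarith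
      · have := hr x A (fun h => Finset.disjoint_left.1 hXB hx (hAB h)) (by omega)
        refine le_trans (real_mono _ fun ω hω => ?_) (this.trans (by norm_num))
        rintro ⟨R, hRA, hRr, hRj⟩
        obtain ⟨R', hR'R, hR'⟩ := Finset.exists_subset_card_eq hRr
        have hmem : R' ∈ {R : Finset V | R ⊆ A ∧ R.card = r ∧ ∀ v ∈ R, ω ∈ joined true {x} v} :=
          ⟨hR'R.trans hRA, hR', fun v hv => hRj v (hR'R hv)⟩
        rw [show {R : Finset V | R ⊆ A ∧ R.card = r ∧ ∀ v ∈ R, ω ∈ joined true {x} v} = ∅ from hω]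
          at hmem
        exact hmem
    refine hmain.trans (le_of_eq ?_)
    rw [hprod]
    field_simp
    ring

/-- Many attempts to grow a set of size `L` from one vertex fail with small probability. -/
lemma real_noGrown_le [Fintype V] (p₁ p₂ : unitInterval) {L r M M' : ℕ} (hL : 1 ≤ L)
    (hM : M' + L * r ≤ M)
    (hr : ∀ (x : V) (A : Finset V), x ∉ A → M' ≤ A.card →
      (bernoulliPi (edgeProb (V := V) p₁ p₂)).real
        {ω | ¬ ∃ R ⊆ A, r ≤ R.card ∧ ∀ v ∈ R, ω ∈ joined true {x} v} ≤ 1 / 2)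
    (hb : ∀ k : ℕ, k < L → (k : ℝ) / (2 * L) ≤ 1 - (1 - (p₂ : ℝ)) ^ (k * r))
    (m : ℕ) (B : Finset V) (hB : M + m * L ≤ B.card) :
    (bernoulliPi (edgeProb (V := V) p₁ p₂)).real (noGrown L B) ≤
      (1 - ∏ i ∈ Finset.Ico 1 L, (i : ℝ) / (4 * L)) ^ m := by
  induction m generalizing B with
  | zero => rw [pow_zero]; exact measureReal_le_one
  | succ m ih =>
    rw [add_mul, one_mul] at hB
    obtain ⟨x, hx⟩ : B.Nonempty := Finset.card_pos.1 (by omega)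
    have hcard := Finset.card_erase_of_mem hx
    have hsub : noGrown L B ⊆ seedFail L {x} x (B.erase x) (B.erase x) := by
      intro ω hω
      refine ⟨noGrown_anti L (Finset.erase_subset _ _) hω, ?_⟩
      rintro ⟨Y, hLY, hY⟩
      refine hω ⟨x, hx, Y, hLY, hY.mono ?_⟩
      rintro e ⟨he, h⟩
      refine ⟨?_, h⟩
      have hxB : ({x} : Finset V) ⊆ B := by simpa using hx
      rcases he with (he | he) | he
      · exact between_subset_inside hxB (Finset.erase_subset _ _) he
      · exact between_subset_inside hxB (Finset.erase_subset _ _) he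
      · exact inside_mono (Finset.erase_subset _ _) he
    have hLr : (L - 1) * r ≤ L * r - r := by rw [Nat.sub_mul, one_mul]
    -- The bound `a` for the fallback event is the induction hypothesis: an attempt uses up at most
    -- `L` vertices of `B`, which leaves enough for the other `m` attempts.
    have := real_seedFail_le p₁ p₂ (M := M + m * L) (a := (1 - ∏ i ∈ Finset.Ico 1 L,
      (i : ℝ) / (4 * L)) ^ m) ih hr hb (L - 1) {x} x (B.erase x) (B.erase x)
      (by rw [Finset.card_singleton]; omega) (by simp) subset_rfl (by simp)
      (by omega) (by omega)
    rw [Finset.card_singleton] at this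
    rw [pow_succ']
    exact (real_mono _ hsub).trans this

end Seed

/-! ### Rounds of growth, and absorption of all vertices -/

section Growth

variable {V : Type*} [DecidableEq V]

/-- The sets of size at least `k` that grow from a single vertex by edges inside `U`. -/
def grownSets (k : ℕ) (U : Finset V) (ω : Edge V → Prop) : Set (Finset V) :=
  {X | X ⊆ U ∧ k ≤ X.card ∧ ∃ x ∈ U, Grows (restrict (inside U) ω) {x} X}

lemma dependsOn_grownSets (k : ℕ) (U : Finset V) : DependsOn (grownSets k U) (inside U) :=
  dependsOn_restrict fun ω => {X : Finset V | X ⊆ U ∧ k ≤ X.card ∧ ∃ x ∈ U, Grows ω {x} X}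

lemma noGrown_of_grownSets_eq_empty {k : ℕ} {U : Finset V} {ω : Edge V → Prop}
    (h : grownSets k U ω = ∅) : ω ∈ noGrown k U := by
  rintro ⟨x, hx, Y, hk, hY⟩
  have hmem : Y ∈ grownSets k U ω := ⟨hY.subset_of_restrict (by simpa using hx), hk, x, hx, hY⟩
  rw [h] at hmem
  exact hmem

/-- Given that a set of size `k` grows inside `U`, every property that only depends on edges outside
`U` may be tested on the grown set. -/
lemma real_le_noGrown_add [Fintype V] (p₁ p₂ : unitInterval) (k : ℕ) (U : Finset V)
    (F : Set (Edge V → Prop)) (H : Finset V → Set (Edge V → Prop)) (T : Finset V → Set (Edge V))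
    (hH : ∀ X ⊆ U, DependsOn (fun ω => ω ∈ H X) (T X) ∧ Disjoint (inside U) (T X))
    (hF : ∀ ω ∈ F, ∀ X ∈ grownSets k U ω, ω ∈ H X) {b : ℝ}
    (hb : ∀ X ⊆ U, k ≤ X.card → (bernoulliPi (edgeProb (V := V) p₁ p₂)).real (H X) ≤ b)
    (hb0 : 0 ≤ b) :
    (bernoulliPi (edgeProb (V := V) p₁ p₂)).real F ≤
      (bernoulliPi (edgeProb (V := V) p₁ p₂)).real (noGrown k U) + b := by
  -- Exploring the grown sets needs `b ≤ a = 1`; for `b > 1` the claim is trivial.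
  rcases le_or_gt b 1 with hb1 | hb1
  · have h := real_le_of_pick (edgeProb (V := V) p₁ p₂) (grownSets k U) (dependsOn_grownSets k U) F
      Set.univ H T (T₀ := ∅) (fun _ _ _ => rfl) (Set.disjoint_empty _)
      (fun X ⟨_, hX⟩ => hH X hX.1) (Set.subset_univ _) hF (a := 1) (b := b)
      (ρ := 1 - (bernoulliPi (edgeProb (V := V) p₁ p₂)).real (noGrown k U)) measureReal_le_one
      (fun X ⟨_, hX⟩ => hb X hX.1 hX.2.1) hb1
      (by rw [sub_sub_cancel]; exact real_mono _ fun ω hω => noGrown_of_grownSets_eq_empty hω)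
    have h0 : 0 ≤ (bernoulliPi (edgeProb (V := V) p₁ p₂)).real (noGrown k U) := measureReal_nonneg
    nlinarith
  · exact (measureReal_le_one.trans hb1.le).trans (le_add_of_nonneg_left measureReal_nonneg)

omit [DecidableEq V] in
lemma disjoint_inside_between {c : Bool} {X Y U : Finset V} (h : Disjoint U Y) :
    Disjoint (inside U) (between c X Y) := by
  rw [between_comm]
  exact (disjoint_between_inside h.symm).symm

/-- One round of growth: a grown set of size `k` in `U` is joined to many vertices of `Y`. -/
lemma real_noGrown_union_le [Fintype V] (p₁ p₂ : unitInterval) (k m : ℕ) (U Y : Finset V)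
    (hUY : Disjoint U Y) {q : ℝ} (hq : q ≤ (1 - (1 - (p₁ : ℝ)) ^ k) * (1 - (1 - (p₂ : ℝ)) ^ k)) :
    (bernoulliPi (edgeProb (V := V) p₁ p₂)).real (noGrown m (U ∪ Y)) ≤
      (bernoulliPi (edgeProb (V := V) p₁ p₂)).real (noGrown k U) +
        2 ^ m * (1 - q / 2) ^ Y.card := by
  have h01 : ∀ (p : unitInterval) (j : ℕ), 0 ≤ (1 - (p : ℝ)) ^ j ∧ (1 - (p : ℝ)) ^ j ≤ 1 :=
    fun p j => ⟨pow_nonneg (by linarith [p.2.2]) _,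
      pow_le_one₀ (by linarith [p.2.2]) (by linarith [p.2.1])⟩
  have hq1 : q ≤ 1 := hq.trans (by nlinarith [h01 p₁ k, h01 p₂ k])
  refine real_le_noGrown_add p₁ p₂ k U _
    (fun X => {ω | ¬ ∃ R ⊆ Y, m ≤ R.card ∧ ∀ v ∈ R, ω ∈ joined true X v ∩ joined false X v})
    (fun X => between true X Y ∪ between false X Y) ?_ ?_ ?_
    (mul_nonneg (by positivity) (pow_nonneg (by linarith) _))
  · intro X _
    refine ⟨?_, (disjoint_inside_between hUY).union_right (disjoint_inside_between hUY)⟩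
    intro ω ω' h
    refine congrArg Not (propext (exists_congr fun R => and_congr_right fun hR =>
      and_congr_right fun _ => forall₂_congr fun v hv => and_congr ?_ ?_))
    · exact iff_of_eq (dependsOn_joined true X v fun e he =>
        h e (Or.inl (between_mono subset_rfl (by simpa using hR hv) he)))
    · exact iff_of_eq (dependsOn_joined false X v fun e he =>
        h e (Or.inr (between_mono subset_rfl (by simpa using hR hv) he)))
  · rintro ω hω X ⟨hXU, -, x, hx, hX⟩ ⟨R, hRY, hm, hR⟩
    refine hω ⟨x, Finset.mem_union_left _ hx, X ∪ R,
      hm.trans (Finset.card_le_card Finset.subset_union_right), Grows.trans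
      (hX.mono fun e he => ⟨inside_mono Finset.subset_union_left he.1, he.2⟩) (Grows.union ?_)⟩
    intro v hv c
    have hvc : ω ∈ joined c X v := by
      cases c
      exacts [(hR v hv).2, (hR v hv).1]
    obtain ⟨u, hu, huv⟩ := hvc
    refine ⟨u, hu, ?_, huv⟩
    exact between_subset_inside (c := c) (hXU.trans Finset.subset_union_left)
      (hRY.trans Finset.subset_union_right) ⟨rfl, u, hu, v, hv, rfl⟩
  · intro X hXU hkX
    have hXY : Disjoint X Y := hUY.mono_left hXU
    refine real_card_lt_le _ (fun v => joined true X v ∩ joined false X v)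
      (fun v => between true X {v} ∪ between false X {v}) (fun v => dependsOn_inter
        (dependsOn_joined true X v) (dependsOn_joined false X v) Set.subset_union_left
        Set.subset_union_right) Y ?_ (by linarith) ?_ m
    · intro v hv w hw hvw
      have hvX : Disjoint {v} X := by simpa using Finset.disjoint_right.1 hXY hv
      have hd : ∀ c c', Disjoint (between c X {v}) (between c' X {w}) := fun c c' =>
        disjoint_between hvX (by simpa using hvw)
      exact ((hd _ _).union_right (hd _ _)).union_left ((hd _ _).union_right (hd _ _))
    · intro v hv
      have hvX : v ∉ X := Finset.disjoint_right.1 hXY hv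
      rw [bernoulliPi_inter _ (dependsOn_joined true X v) (dependsOn_joined false X v)
        (disjoint_between_color (by decide)), real_joined _ _ _ _ _ hvX, real_joined _ _ _ _ _ hvX]
      refine hq.trans ?_
      simp only [if_true, Bool.false_eq_true, if_false]
      have hanti : ∀ p : unitInterval, (1 - (p : ℝ)) ^ X.card ≤ (1 - (p : ℝ)) ^ k := fun p =>
        pow_le_pow_of_le_one (by linarith [p.2.2]) (by linarith [p.2.1]) hkX
      refine mul_le_mul (by linarith [hanti p₁]) (by linarith [hanti p₂])
        (by linarith [h01 p₂ k]) (by linarith [h01 p₁ X.card])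

/-- A grown set of size `m` in `U` is likely to be joined to all vertices of `Z` in blue. -/
lemma real_not_all_joined_le [Fintype V] (p₁ p₂ : unitInterval) (m : ℕ) (U Z : Finset V)
    (hUZ : Disjoint U Z) :
    (bernoulliPi (edgeProb (V := V) p₁ p₂)).real
      {ω | ¬ ∃ X ∈ grownSets m U ω, ∀ z ∈ Z, ω ∈ joined false X z} ≤
      (bernoulliPi (edgeProb (V := V) p₁ p₂)).real (noGrown m U) +
        Z.card * (1 - (p₂ : ℝ)) ^ m := by
  have hp0 : 0 ≤ 1 - (p₂ : ℝ) := by linarith [p₂.2.2]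
  refine real_le_noGrown_add p₁ p₂ m U _ (fun X => {ω | ¬ ∀ z ∈ Z, ω ∈ joined false X z})
    (fun X => between false X Z) ?_ ?_ ?_ (by positivity)
  · intro X _
    refine ⟨fun ω ω' h => congrArg Not (propext (forall₂_congr fun z hz => ?_)),
      disjoint_inside_between hUZ⟩
    exact iff_of_eq (dependsOn_joined false X z fun e he =>
      h e (between_mono subset_rfl (by simpa using hz) he))
  · exact fun ω hω X hX h => hω ⟨X, hX, h⟩
  · intro X hXU hmX
    have hsub : {ω : Edge V → Prop | ¬ ∀ z ∈ Z, ω ∈ joined false X z} ⊆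
        ⋃ z ∈ Z, (joined false X z)ᶜ := by
      intro ω hω
      simp only [Set.mem_ofPred_eq, not_forall] at hω
      obtain ⟨z, hz, h⟩ := hω
      exact Set.mem_biUnion (x := z) hz h
    refine (real_mono _ hsub).trans ((measureReal_biUnion_finset_le _ _).trans ?_)
    rw [← nsmul_eq_mul]
    refine Finset.sum_le_card_nsmul _ _ _ fun z hz => ?_
    rw [real_compl, real_joined _ _ _ _ _ (Finset.disjoint_right.1 (hUZ.mono_left hXU) hz)]
    simp only [Bool.false_eq_true, if_false, sub_sub_cancel]
    exact pow_le_pow_of_le_one hp0 (by linarith [p₂.2.1]) hmX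

/-- Every set of at most half of the vertices of `Z` is joined in red to the rest of `Z`. -/
def redExpands (Z : Finset V) : Set (Edge V → Prop) :=
  {ω | ∀ S ⊆ Z, S.Nonempty → 2 * S.card ≤ Z.card → ∃ u ∈ S, ∃ v ∈ Z \ S, ω (true, s(u, v))}

/-- Union bound over the sets `S`: at least `|S| * (|Z| / 2)` red edges are absent, and the binomial
theorem sums `x ^ |S|` over the nonempty subsets of `Z`. -/
lemma real_not_redExpands_le [Fintype V] (p₁ p₂ : unitInterval) (Z : Finset V) :
    (bernoulliPi (edgeProb (V := V) p₁ p₂)).real (redExpands Z)ᶜ ≤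
      (1 + (1 - (p₁ : ℝ)) ^ (Z.card / 2)) ^ Z.card - 1 := by
  have hp0 : 0 ≤ 1 - (p₁ : ℝ) := by linarith [p₁.2.2]
  set x := (1 - (p₁ : ℝ)) ^ (Z.card / 2) with hx
  let N := Z.powerset.filter fun S => S.Nonempty ∧ 2 * S.card ≤ Z.card
  have hsub : (redExpands Z)ᶜ ⊆ ⋃ S ∈ N,
      {ω : Edge V → Prop | ∀ u ∈ S, ∀ v ∈ Z \ S, ¬ ω (true, s(u, v))} := by
    intro ω hω
    simp only [redExpands, Set.mem_compl_iff, Set.mem_ofPred_eq] at hω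
    push Not at hω
    obtain ⟨S, hSZ, hne, hc, h⟩ := hω
    exact Set.mem_biUnion (x := S)
      (by simp only [N, Finset.coe_filter, Set.mem_ofPred_eq, Finset.mem_powerset]
          exact ⟨hSZ, hne, hc⟩) h
  refine (real_mono _ hsub).trans ((measureReal_biUnion_finset_le _ _).trans ?_)
  have hterm : ∀ S ∈ N, (bernoulliPi (edgeProb (V := V) p₁ p₂)).real
      {ω : Edge V → Prop | ∀ u ∈ S, ∀ v ∈ Z \ S, ¬ ω (true, s(u, v))} ≤ x ^ S.card := by
    intro S hS
    simp only [N, Finset.mem_filter, Finset.mem_powerset] at hS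
    rw [real_edges_absent _ _ _ _ _ Finset.disjoint_sdiff, hx, ← pow_mul, if_pos rfl]
    refine pow_le_pow_of_le_one hp0 (by linarith [p₁.2.1]) ?_
    rw [mul_comm]
    refine Nat.mul_le_mul_left _ ?_
    rw [Finset.card_sdiff_of_subset hS.1]
    omega
  refine (Finset.sum_le_sum hterm).trans ?_
  have hsum := Finset.sum_pow_mul_eq_add_pow x 1 Z
  simp only [one_pow, mul_one] at hsum
  rw [add_comm 1 x, ← hsum, ← Finset.add_sum_erase _ _ (Finset.empty_mem_powerset Z)]
  simp only [Finset.card_empty, pow_zero, add_sub_cancel_left]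
  refine Finset.sum_le_sum_of_subset_of_nonneg ?_ fun S _ _ => by positivity
  intro S hS
  simp only [N, Finset.mem_filter] at hS
  exact Finset.mem_erase.2 ⟨hS.2.1.ne_empty, hS.1⟩

/-- Every vertex outside `Z` is joined to `Z` in both colours. -/
def dominates [Fintype V] (Z : Finset V) : Set (Edge V → Prop) :=
  {ω | ∀ v ∉ Z, ∀ c, ω ∈ joined c Z v}

lemma real_not_dominates_le [Fintype V] (p₁ p₂ : unitInterval) (Z : Finset V) :
    (bernoulliPi (edgeProb (V := V) p₁ p₂)).real (dominates Z)ᶜ ≤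
      Fintype.card V * ((1 - (p₁ : ℝ)) ^ Z.card + (1 - (p₂ : ℝ)) ^ Z.card) := by
  have hp1 : 0 ≤ 1 - (p₁ : ℝ) := by linarith [p₁.2.2]
  have hp2 : 0 ≤ 1 - (p₂ : ℝ) := by linarith [p₂.2.2]
  have hsub : (dominates Z)ᶜ ⊆ ⋃ v ∈ Zᶜ, ((joined true Z v)ᶜ ∪ (joined false Z v)ᶜ) := by
    intro ω hω
    simp only [dominates, Set.mem_compl_iff, Set.mem_ofPred_eq] at hω
    push Not at hω
    obtain ⟨v, hv, c, hc⟩ := hω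
    refine Set.mem_biUnion (x := v) (by simpa using hv) ?_
    cases c
    exacts [Or.inr hc, Or.inl hc]
  refine (real_mono _ hsub).trans ((measureReal_biUnion_finset_le _ _).trans ?_)
  have hterm : ∀ v ∈ Zᶜ, (bernoulliPi (edgeProb (V := V) p₁ p₂)).real
      ((joined true Z v)ᶜ ∪ (joined false Z v)ᶜ) ≤
      (1 - (p₁ : ℝ)) ^ Z.card + (1 - (p₂ : ℝ)) ^ Z.card := by
    intro v hv
    have hv' : v ∉ Z := by simpa using hv
    refine (measureReal_union_le _ _).trans (le_of_eq ?_)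
    rw [real_compl, real_compl, real_joined _ _ _ _ _ hv', real_joined _ _ _ _ _ hv']
    simp
  refine (Finset.sum_le_card_nsmul _ _ _ hterm).trans ?_
  rw [nsmul_eq_mul]
  gcongr
  exact_mod_cast Finset.card_le_univ _

/-- Take a largest set `M` grown from `X`. Vertices of `Z` already have a blue edge to `M`, so a red
one suffices to add them. Domination of a vertex of `X` gives a first vertex in `Z ∩ M`. As long as
`Z` is not exhausted, red expansion of the smaller of `Z ∩ M` and `Z \ M` gives a red edge between
them. Once `Z ⊆ M`, domination adds the rest. -/
lemma percolates_of_joined [Fintype V] {ω : Edge V → Prop} {m : ℕ} (hm : 1 ≤ m) {U X Z : Finset V}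
    (hUZ : Disjoint U Z) (hX : X ∈ grownSets m U ω) (hXZ : ∀ z ∈ Z, ω ∈ joined false X z)
    (hZ : ω ∈ redExpands Z) (hdom : ω ∈ dominates Z) : Percolates (toDouble ω) := by
  classical
  obtain ⟨hXU, hmX, x, hx, hgrow⟩ := hX
  replace hgrow : Grows ω {x} X := hgrow.mono fun e he => he.2
  obtain ⟨M, hM, hmax⟩ := (Finset.univ.filter fun M => Grows ω X M).exists_max_image Finset.card
    ⟨X, by simpa using Grows.refl⟩
  simp only [Finset.mem_filter, Finset.mem_univ, true_and] at hM hmax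
  have hXM : X ⊆ M := hM.subset
  have hadd : ∀ v, (∃ u ∈ M, ω (true, s(u, v))) → (∃ u ∈ M, ω (false, s(u, v))) → v ∈ M := by
    intro v hr hb
    by_contra hv
    have := hmax _ (hM.insert hv hr hb)
    rw [Finset.card_insert_of_notMem hv] at this
    omega
  have haddZ : ∀ z ∈ Z, (∃ u ∈ M, ω (true, s(u, z))) → z ∈ M := by
    intro z hz hr
    obtain ⟨u, hu, hb⟩ := hXZ z hz
    exact hadd z hr ⟨u, hXM hu, hb⟩
  have hsymm : ∀ {c : Bool} {a b : V}, ω (c, s(a, b)) → ω (c, s(b, a)) := fun h => by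
    rwa [Sym2.eq_swap]
  have hZM : Z ⊆ M := by
    by_contra hnot
    have hne : (Z ∩ M).Nonempty := by
      obtain ⟨y, hy⟩ : X.Nonempty := Finset.card_pos.1 (by omega)
      obtain ⟨z, hz, hzy⟩ := hdom y (Finset.disjoint_left.1 hUZ (hXU hy)) true
      exact ⟨z, Finset.mem_inter.2 ⟨hz, haddZ z hz ⟨y, hXM hy, hsymm hzy⟩⟩⟩
    have hne' : (Z \ M).Nonempty := Finset.sdiff_nonempty.2 hnot
    have hcard := Finset.card_inter_add_card_sdiff Z M
    obtain ⟨u, hu, v, hv, huv⟩ : ∃ u ∈ Z ∩ M, ∃ v ∈ Z \ M, ω (true, s(u, v)) := by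
      by_cases hc : 2 * (Z ∩ M).card ≤ Z.card
      · obtain ⟨u, hu, v, hv, huv⟩ := hZ _ Finset.inter_subset_left hne hc
        exact ⟨u, hu, v, by simpa using hv, huv⟩
      · obtain ⟨u, hu, v, hv, huv⟩ := hZ _ Finset.sdiff_subset hne' (by omega)
        exact ⟨v, by simpa using hv, u, hu, hsymm huv⟩
    exact (Finset.mem_sdiff.1 hv).2 (haddZ v (Finset.mem_sdiff.1 hv).1
      ⟨u, (Finset.mem_inter.1 hu).2, huv⟩)
  have hMuniv : M = Finset.univ := by
    refine Finset.eq_univ_of_forall fun v => ?_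
    by_cases hv : v ∈ Z
    · exact hZM hv
    · have hj : ∀ c, ∃ u ∈ M, ω (c, s(u, v)) := fun c => by
        obtain ⟨u, hu, huv⟩ := hdom v hv c
        exact ⟨u, hZM hu, huv⟩
      exact hadd v (hj true) (hj false)
  rw [hMuniv] at hM
  exact percolates_of_grows_univ (hgrow.trans hM)

/-- Union bound over the failures of the hypotheses of `percolates_of_joined`; the first two terms
together bound the failure to find a grown set joined in blue to all of `Z`. -/
lemma one_sub_percolationProb_le (n : ℕ) (p₁ p₂ : unitInterval) {m : ℕ} (hm : 1 ≤ m)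
    (U Z : Finset (Fin n)) (hUZ : Disjoint U Z) :
    1 - percolationProb n p₁ p₂ ≤
      (bernoulliPi (edgeProb (V := Fin n) p₁ p₂)).real (noGrown m U) +
        Z.card * (1 - (p₂ : ℝ)) ^ m +
        ((1 + (1 - (p₁ : ℝ)) ^ (Z.card / 2)) ^ Z.card - 1) +
        n * ((1 - (p₁ : ℝ)) ^ Z.card + (1 - (p₂ : ℝ)) ^ Z.card) := by
  rw [percolationProb_eq, ← real_compl]
  have hsub : {ω : Edge (Fin n) → Prop | Percolates (toDouble ω)}ᶜ ⊆
      ({ω | ¬ ∃ X ∈ grownSets m U ω, ∀ z ∈ Z, ω ∈ joined false X z} ∪ (redExpands Z)ᶜ) ∪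
        (dominates Z)ᶜ := by
    intro ω hω
    by_contra hcon
    simp only [Set.mem_union, not_or, Set.mem_ofPred_eq, Set.mem_compl_iff, not_not] at hcon hω
    obtain ⟨⟨⟨X, hX, hXZ⟩, hZ⟩, hdom⟩ := hcon
    exact hω (percolates_of_joined hm hUZ hX hXZ hZ hdom)
  have h3 := real_not_dominates_le p₁ p₂ Z
  rw [Fintype.card_fin] at h3
  exact (real_mono _ hsub).trans ((measureReal_union_le _ _).trans
    (add_le_add ((measureReal_union_le _ _).trans (add_le_add
      (real_not_all_joined_le p₁ p₂ m U Z hUZ) (real_not_redExpands_le p₁ p₂ Z))) h3))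

end Growth

/-! ### Elementary inequalities -/

section Estimates

lemma one_sub_pow_le_exp {p : ℝ} (hp1 : p ≤ 1) (k : ℕ) : (1 - p) ^ k ≤ Real.exp (-(p * k)) := by
  calc (1 - p) ^ k ≤ Real.exp (-p) ^ k :=
        pow_le_pow_left₀ (by linarith) (Real.one_sub_le_exp_neg p) k
    _ = Real.exp (-(p * k)) := by rw [← Real.exp_nat_mul]; ring_nf

lemma exp_neg_le_one_div {y : ℝ} (hy : 0 < y) : Real.exp (-y) ≤ 1 / y := by
  rw [Real.exp_neg, ← one_div]
  exact one_div_le_one_div_of_le hy (by linarith [Real.add_one_le_exp y])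

/-- Follows from `e⁻ˣ ≤ 1/(1+x) ≤ 1 - x/2` on `[0, 1]`. -/
lemma half_le_one_sub_pow {p x : ℝ} (hp1 : p ≤ 1) (hx0 : 0 ≤ x) (hx1 : x ≤ 1) {k : ℕ}
    (hx : x ≤ p * k) : x / 2 ≤ 1 - (1 - p) ^ k := by
  have h1 : (1 - p) ^ k ≤ Real.exp (-x) :=
    (one_sub_pow_le_exp hp1 k).trans (Real.exp_le_exp.2 (by linarith))
  have h2 : Real.exp (-x) ≤ 1 - x / 2 := by
    rw [Real.exp_neg, inv_le_comm₀ (Real.exp_pos x) (by linarith)]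
    refine le_trans ?_ (Real.add_one_le_exp x)
    rw [inv_le_iff_one_le_mul₀ (by linarith)]
    nlinarith
  linarith

lemma two_pow_mul_pow_le {q : ℝ} (hq : q ≤ 2) {m N : ℕ} (h : 4 * m ≤ q * N) :
    2 ^ m * (1 - q / 2) ^ N ≤ Real.exp (-m) := by
  have h1 : (1 - q / 2) ^ N ≤ Real.exp (-(2 * m)) :=
    (one_sub_pow_le_exp (by linarith) N).trans (Real.exp_le_exp.2 (by linarith))
  have h2 : (2 : ℝ) ^ m ≤ Real.exp m := by
    have : (2 : ℝ) ≤ Real.exp 1 := by linarith [Real.add_one_le_exp 1]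
    calc (2 : ℝ) ^ m ≤ Real.exp 1 ^ m := pow_le_pow_left₀ (by norm_num) this m
      _ = Real.exp m := by rw [← Real.exp_nat_mul, mul_one]
  calc 2 ^ m * (1 - q / 2) ^ N ≤ Real.exp m * Real.exp (-(2 * m)) :=
        mul_le_mul h2 h1 (pow_nonneg (by linarith) _) (Real.exp_pos _).le
    _ = Real.exp (-m) := by rw [← Real.exp_add]; ring_nf

/-- The product is `(L-1)! / (4L)^(L-1)`. Here `L^(L-1) ≤ e^L (L-1)!` by Stirling's lower bound, and
`4^(L-1) ≤ e^(2L)`. -/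
lemma exp_neg_le_prod (L : ℕ) (hL : 1 ≤ L) :
    Real.exp (-(3 * L)) ≤ ∏ i ∈ Finset.Ico 1 L, (i : ℝ) / (4 * L) := by
  have hLpos : (0 : ℝ) < L := by exact_mod_cast hL
  have hfact : (L : ℝ) ^ L ≤ Real.exp L * L.factorial := by
    have := Real.pow_div_factorial_le_exp (L : ℝ) hLpos.le L
    rwa [div_le_iff₀ (by positivity)] at this
  obtain ⟨j, rfl⟩ : ∃ j, L = j + 1 := ⟨L - 1, by omega⟩
  rw [Finset.prod_div_distrib, Finset.prod_const, Nat.card_Ico, Nat.add_sub_cancel,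
    ← Nat.cast_prod, Finset.prod_Ico_id_eq_factorial, le_div_iff₀ (by positivity)]
  rw [Nat.factorial_succ, pow_succ] at hfact
  set x : ℝ := ((j + 1 : ℕ) : ℝ) with hx
  have h1 : x ^ j ≤ Real.exp x * j.factorial := by
    push_cast at hfact
    have hx' : (j : ℝ) + 1 = x := by rw [hx]; push_cast; rfl
    rw [hx'] at hfact
    exact le_of_mul_le_mul_right (by linarith) hLpos
  have h4 : (4 : ℝ) ^ j ≤ Real.exp (2 * x) := by
    have h2 : (4 : ℝ) ≤ Real.exp 2 := by
      have : Real.exp 2 = Real.exp 1 ^ 2 := by rw [← Real.exp_nat_mul]; norm_num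
      rw [this]
      nlinarith [Real.add_one_le_exp 1]
    calc (4 : ℝ) ^ j ≤ Real.exp 2 ^ j := pow_le_pow_left₀ (by norm_num) h2 j
      _ = Real.exp (j * 2) := by rw [← Real.exp_nat_mul]
      _ ≤ Real.exp (2 * x) := Real.exp_le_exp.2 (by rw [hx]; push_cast; linarith)
  calc Real.exp (-(3 * x)) * (4 * x) ^ j = Real.exp (-(3 * x)) * (4 ^ j * x ^ j) := by
        rw [mul_pow]
    _ ≤ Real.exp (-(3 * x)) * (Real.exp (2 * x) * (Real.exp x * j.factorial)) := by gcongr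
    _ = (Real.exp (-(3 * x)) * Real.exp (2 * x) * Real.exp x) * j.factorial := by ring
    _ = j.factorial := by
        rw [← Real.exp_add, ← Real.exp_add, show -(3 * x) + 2 * x + x = 0 by ring, Real.exp_zero,
          one_mul]

/-- The first `t` vertices. -/
def initial (n t : ℕ) : Finset (Fin n) := Finset.univ.filter fun v => v.val < t

lemma card_initial {n t : ℕ} (h : t ≤ n) : (initial n t).card = t := by
  rw [initial, Fin.card_filter_val_lt, min_eq_right h]

lemma initial_mono {n s t : ℕ} (h : s ≤ t) : initial n s ⊆ initial n t := by
  intro v hv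
  simp only [initial, Finset.mem_filter, Finset.mem_univ, true_and] at hv ⊢
  omega

lemma eight_mul_log_cube_le {n : ℕ} (hℓ : 200 ≤ Real.log n) :
    8 * Real.log n ^ 3 ≤ n ∧ Real.exp (Real.log n) = n ∧ (0 : ℝ) < n := by
  have hn0 : (0 : ℝ) < n := by
    rcases Nat.eq_zero_or_pos n with rfl | h
    · simp at hℓ; linarith
    · exact_mod_cast h
  have hexp := Real.exp_log hn0
  refine ⟨?_, hexp, hn0⟩
  have := Real.pow_div_factorial_le_exp (Real.log n) (by linarith) 4
  rw [hexp, show ((Nat.factorial 4 : ℕ) : ℝ) = 24 by norm_num [Nat.factorial]] at this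
  refine le_trans ?_ this
  rw [le_div_iff₀ (by norm_num)]
  have : 0 ≤ Real.log n ^ 3 := pow_nonneg (by linarith) 3
  nlinarith

/-- The choice `L ≈ ℓ / 12` makes `Q` at least `n^(-1/4)/27`, and there are `m ≥ n/(12ℓ)` attempts,
so `Q * m` is at least of order `n^(3/4)/ℓ`. -/
lemma log_le_prod_mul {n ℓ L Q m : ℝ} (hexp : Real.exp ℓ = n) (hℓ : 200 ≤ ℓ)
    (hn64 : 320000 * ℓ ≤ n) (hL2 : L < ℓ / 12 + 1) (hLpos : 0 < L)
    (hQ1 : Real.exp (-(3 * L)) ≤ Q) (hm2 : n / (32 * L) < m + 1) : ℓ ≤ Q * m := by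
  have hℓ0 : 0 < ℓ := by linarith
  have hn0 : 0 < n := by linarith
  have hQ0 : 0 ≤ Q := (Real.exp_pos _).le.trans hQ1
  have he3 : Real.exp 3 ≤ 27 := by
    have : Real.exp 3 = Real.exp 1 ^ 3 := by rw [← Real.exp_nat_mul]; norm_num
    rw [this]
    calc Real.exp 1 ^ 3 ≤ 3 ^ 3 := by
          gcongr
          linarith [Real.exp_one_lt_d9]
      _ = 27 := by norm_num
  have hL6 : L ≤ ℓ / 6 := by linarith
  have hmL : n / (12 * ℓ) ≤ m := by
    have h : n / (32 * (ℓ / 6)) ≤ n / (32 * L) := by gcongr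
    have h' : n / (32 * (ℓ / 6)) = n / (12 * ℓ) + (5 / 48) * (n / ℓ) := by
      field_simp; norm_num
    have h'' : 1 ≤ (5 / 48) * (n / ℓ) := by
      rw [← mul_div_assoc, le_div_iff₀ hℓ0]
      linarith
    linarith
  have hQe : Real.exp (-(ℓ / 4)) / 27 ≤ Q := by
    refine le_trans ?_ hQ1
    rw [div_le_iff₀ (by norm_num)]
    calc Real.exp (-(ℓ / 4)) = Real.exp (-(ℓ / 4) - 3) * Real.exp 3 := by
          rw [← Real.exp_add]; ring_nf
      _ ≤ Real.exp (-(3 * L)) * 27 := by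
          gcongr
          linarith
  have hpow : ℓ ^ 4 / 76 ≤ Real.exp (3 * ℓ / 4) := by
    have := Real.pow_div_factorial_le_exp (3 * ℓ / 4) (by positivity) 4
    rw [show ((Nat.factorial 4 : ℕ) : ℝ) = 24 by norm_num [Nat.factorial]] at this
    refine le_trans ?_ this
    have : 0 ≤ ℓ ^ 4 := by positivity
    rw [show (3 * ℓ / 4) ^ 4 / 24 = ℓ ^ 4 * (81 / 6144) by ring]
    nlinarith
  calc ℓ ≤ ℓ ^ 4 / 76 / (27 * (12 * ℓ)) := by
        rw [div_div, le_div_iff₀ (by positivity)]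
        have h : 40000 ≤ ℓ ^ 2 := by nlinarith
        nlinarith [mul_le_mul_of_nonneg_left h (sq_nonneg ℓ)]
    _ ≤ Real.exp (3 * ℓ / 4) / (27 * (12 * ℓ)) := by gcongr
    _ = Real.exp (-(ℓ / 4)) / 27 * (n / (12 * ℓ)) := by
        rw [← hexp, show 3 * ℓ / 4 = -(ℓ / 4) + ℓ by ring, Real.exp_add]
        field_simp
    _ ≤ Q * m := by gcongr

end Estimates

/-! ### The seed above the threshold -/

section Supercritical

variable {n : ℕ} {p₁ p₂ : unitInterval}

/-- A set of logarithmic size grows inside any quarter of the vertices. -/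
lemma real_noGrown_seed_le (hℓ : 200 ≤ Real.log n)
    (h12 : 100000 / (n * Real.log n) ≤ (p₁ : ℝ) * p₂) (h1 : 100000 * Real.log n / n ≤ (p₁ : ℝ))
    (h2 : 100000 * Real.log n / n ≤ (p₂ : ℝ)) :
    (bernoulliPi (edgeProb (V := Fin n) p₁ p₂)).real
      (noGrown ⌈Real.log n / 12⌉₊ (initial n (n / 4))) ≤ 1 / Real.log n := by
  obtain ⟨hcube, hexp, hn0⟩ := eight_mul_log_cube_le hℓ
  set ℓ := Real.log n with hℓdef
  have hℓ0 : 0 < ℓ := by linarith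
  set L := ⌈ℓ / 12⌉₊ with hL
  have hL1 : ℓ / 12 ≤ L := Nat.le_ceil _
  have hL2 : (L : ℝ) < ℓ / 12 + 1 := Nat.ceil_lt_add_one (by positivity)
  have hLpos : (0 : ℝ) < L := by linarith
  have hLnat : 1 ≤ L := by exact_mod_cast (by linarith : (0 : ℝ) + 1 ≤ (L : ℝ))
  have hp1 : 0 < (p₁ : ℝ) := lt_of_lt_of_le (by positivity) h1
  have hp2 : 0 < (p₂ : ℝ) := lt_of_lt_of_le (by positivity) h2
  have hp1' : (p₁ : ℝ) ≤ 1 := p₁.2.2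
  have hp2' : (p₂ : ℝ) ≤ 1 := p₂.2.2
  -- With this `r`, the expected number of blue edges from `k` vertices to `r` vertices is at least
  -- `k / L`.
  set r := ⌈1 / (p₂ * L : ℝ)⌉₊ with hr
  have hr1 : 1 / (p₂ * L : ℝ) ≤ r := Nat.le_ceil _
  have hr2 : (r : ℝ) < 1 / (p₂ * L) + 1 := Nat.ceil_lt_add_one (by positivity)
  have hrpos : (0 : ℝ) < r := lt_of_lt_of_le (by positivity) hr1
  have hrnat : 1 ≤ r := by exact_mod_cast hrpos
  -- Among `M'` vertices the expected red degree is at least `4r`, so by `two_pow_mul_pow_le` it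
  -- falls below `r` with probability at most `e^(-r) ≤ 1/2`.
  set M' := ⌈4 * r / (p₁ : ℝ)⌉₊ with hM'
  have hM1 : 4 * r / (p₁ : ℝ) ≤ M' := Nat.le_ceil _
  have hM2 : (M' : ℝ) < 4 * r / p₁ + 1 := Nat.ceil_lt_add_one (by positivity)
  set m := ⌊(n : ℝ) / (32 * L)⌋₊ with hm
  have hm1 : (m : ℝ) ≤ n / (32 * L) := Nat.floor_le (by positivity)
  have hm2 : (n : ℝ) / (32 * L) < m + 1 := Nat.lt_floor_add_one _
  have hinv1 : 1 / (p₁ : ℝ) ≤ n / (100000 * ℓ) := by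
    rw [div_le_div_iff₀ hp1 (by positivity), one_mul]
    rw [div_le_iff₀ hn0] at h1
    linarith
  have hinv2 : 1 / (p₂ : ℝ) ≤ n / (100000 * ℓ) := by
    rw [div_le_div_iff₀ hp2 (by positivity), one_mul]
    rw [div_le_iff₀ hn0] at h2
    linarith
  have hinv12 : 1 / ((p₁ : ℝ) * p₂) ≤ n * ℓ / 100000 := by
    rw [div_le_div_iff₀ (by positivity) (by norm_num), one_mul]
    rw [div_le_iff₀ (by positivity)] at h12
    linarith
  have hnℓ : (n : ℝ) / (100000 * ℓ) ≤ n / 100000 := by gcongr; linarith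
  have hn64 : 320000 * ℓ ≤ n := by
    have h : 40000 ≤ ℓ ^ 2 := by nlinarith
    calc 320000 * ℓ = 8 * (40000 * ℓ) := by ring
      _ ≤ 8 * (ℓ ^ 2 * ℓ) := by gcongr
      _ = 8 * ℓ ^ 3 := by ring
      _ ≤ n := hcube
  have hb1 : 4 * r / (p₁ : ℝ) ≤ n / 1000 := by
    calc 4 * r / (p₁ : ℝ) ≤ 4 * (1 / (p₂ * L) + 1) / p₁ := by gcongr
      _ = 4 / L * (1 / (p₁ * p₂)) + 4 * (1 / p₁) := by field_simp
      _ ≤ 4 / (ℓ / 12) * (n * ℓ / 100000) + 4 * (n / 100000) := by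
          refine add_le_add ?_ (by linarith)
          gcongr
      _ ≤ n / 1000 := by
          have : 4 / (ℓ / 12) * (n * ℓ / 100000) = 48 * n / 100000 := by field_simp; norm_num
          rw [this]
          linarith
  have hb2 : (L : ℝ) * r ≤ n / 1000 := by
    calc (L : ℝ) * r ≤ L * (1 / (p₂ * L) + 1) := by gcongr
      _ = 1 / p₂ + L := by field_simp
      _ ≤ n / 100000 + (ℓ / 12 + 1) := by linarith
      _ ≤ n / 1000 := by linarith
  have hb3 : (m : ℝ) * L ≤ n / 32 := by
    calc (m : ℝ) * L ≤ n / (32 * L) * L := by gcongr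
      _ = n / 32 := by field_simp
  have hquarter : (n : ℝ) / 4 - 1 ≤ (n / 4 : ℕ) := by
    have : n < 4 * (n / 4) + 4 := by omega
    have : (n : ℝ) < 4 * (n / 4 : ℕ) + 4 := by exact_mod_cast this
    linarith
  have hB : M' + L * r + m * L ≤ (initial n (n / 4)).card := by
    rw [card_initial (Nat.div_le_self n 4)]
    have : ((M' + L * r + m * L : ℕ) : ℝ) ≤ (n / 4 : ℕ) := by
      push_cast
      linarith
    exact_mod_cast this
  refine (real_noGrown_le p₁ p₂ hLnat le_rfl ?_ ?_ m _ hB).trans ?_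
  · intro x A hxA hA
    have hjoin : ∀ v ∈ A, (p₁ : ℝ) ≤
        (bernoulliPi (edgeProb (V := Fin n) p₁ p₂)).real (joined true {x} v) := by
      intro v hv
      rw [real_joined _ _ _ _ _ (by rintro h; rw [Finset.mem_singleton] at h; exact hxA (h ▸ hv))]
      simp
    refine (real_card_lt_le _ _ _ (dependsOn_joined true {x}) A ?_ (by linarith) hjoin r).trans ?_
    · intro v hv w hw hvw
      refine disjoint_between ?_ (by simpa using hvw)
      rw [Finset.disjoint_singleton]
      rintro rfl
      exact hxA hv
    · refine (two_pow_mul_pow_le (by linarith) ?_).trans ?_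
      · rw [div_le_iff₀ hp1] at hM1
        have : (M' : ℝ) ≤ A.card := by exact_mod_cast hA
        nlinarith
      · have hr1' : (1 : ℝ) ≤ r := by exact_mod_cast hrnat
        rw [Real.exp_neg, inv_le_comm₀ (Real.exp_pos _) (by norm_num)]
        linarith [Real.add_one_le_exp (r : ℝ)]
  · intro k hk
    have hk' : (k : ℝ) ≤ L := by exact_mod_cast hk.le
    have := half_le_one_sub_pow (p := (p₂ : ℝ)) (x := k / L) (k := k * r) hp2' (by positivity)
      ((div_le_one hLpos).2 hk') ?_
    · calc (k : ℝ) / (2 * L) = k / L / 2 := by field_simp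
        _ ≤ _ := this
    · rw [div_le_iff₀ (by positivity)] at hr1
      rw [div_le_iff₀ hLpos]
      push_cast
      calc (k : ℝ) = k * 1 := (mul_one _).symm
        _ ≤ k * (r * (p₂ * L)) := by gcongr
        _ = p₂ * (k * r) * L := by ring
  · set Q := ∏ i ∈ Finset.Ico 1 L, (i : ℝ) / (4 * L) with hQ
    have hQ1 : Real.exp (-(3 * L)) ≤ Q := exp_neg_le_prod L hLnat
    have hQ2 : Q ≤ 1 := by
      refine Finset.prod_le_one (fun i _ => by positivity) fun i hi => ?_
      have : (i : ℝ) ≤ L := by exact_mod_cast (Finset.mem_Ico.1 hi).2.le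
      rw [div_le_one (by positivity)]
      linarith
    have hQm : ℓ ≤ Q * m := log_le_prod_mul hexp hℓ hn64 hL2 hLpos hQ1 hm2
    calc (1 - Q) ^ m ≤ Real.exp (-(Q * m)) := one_sub_pow_le_exp hQ2 m
      _ ≤ Real.exp (-ℓ) := Real.exp_le_exp.2 (by linarith)
      _ ≤ 1 / ℓ := exp_neg_le_one_div hℓ0

end Supercritical

/-! ### Doubling, the last round, and percolation above the threshold -/

section Doubling

variable {n : ℕ} {p₁ p₂ : unitInterval}

lemma initial_union_sdiff {s t : ℕ} (h : s ≤ t) :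
    initial n s ∪ (initial n t \ initial n s) = initial n t :=
  Finset.union_sdiff_of_subset (initial_mono h)

lemma card_initial_sdiff {s t : ℕ} (h : s ≤ t) (ht : t ≤ n) :
    (initial n t \ initial n s).card = t - s := by
  rw [Finset.card_sdiff_of_subset (initial_mono h), card_initial ht, card_initial (h.trans ht)]

/-- As long as the blue degree into the grown set is below one, the grown set doubles in size. -/
lemma real_noGrown_doubling_le (hℓ : 200 ≤ Real.log n) (h21 : (p₁ : ℝ) ≤ p₂)
    (h12 : 100000 / (n * Real.log n) ≤ (p₁ : ℝ) * p₂) (h1 : 100000 * Real.log n / n ≤ (p₁ : ℝ))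
    {L : ℕ} (hL : Real.log n / 12 ≤ L) (j : ℕ) (hj : ∀ i < j, ((2 ^ i * L : ℕ) : ℝ) * p₂ < 1) :
    (bernoulliPi (edgeProb (V := Fin n) p₁ p₂)).real
      (noGrown (2 ^ j * L) (initial n (2 * (n / 4) - n / 4 / 2 ^ j))) ≤
      (bernoulliPi (edgeProb (V := Fin n) p₁ p₂)).real (noGrown L (initial n (n / 4))) +
        (1 - 1 / 2 ^ j) / L := by
  obtain ⟨hcube, hexp, hn0⟩ := eight_mul_log_cube_le hℓ
  set ℓ := Real.log n with hℓdef
  have hℓ0 : 0 < ℓ := by linarith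
  have hLpos : (0 : ℝ) < L := by linarith
  have hp1 : 0 < (p₁ : ℝ) := lt_of_lt_of_le (by positivity) h1
  have hp1' : (p₁ : ℝ) ≤ 1 := p₁.2.2
  have hp2' : (p₂ : ℝ) ≤ 1 := p₂.2.2
  induction j with
  | zero => simp [two_mul]
  | succ j ih =>
    have ih' := ih fun i hi => hj i (by omega)
    have hk1 := hj j (Nat.lt_succ_self j)
    set k := 2 ^ j * L with hk
    have hkpos : (0 : ℝ) < k := by rw [hk]; push_cast; positivity
    set b := n / 4 with hb
    have hbn : 4 * b ≤ n := by omega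
    have hb8 : (n : ℝ) / 8 ≤ b := by
      have h4 : n < 4 * b + 4 := by omega
      have h4' : (n : ℝ) < 4 * b + 4 := by exact_mod_cast h4
      have : 1600 ≤ (n : ℝ) := by
        have h : (40000 : ℝ) * 200 ≤ ℓ ^ 3 := by nlinarith [mul_self_nonneg (ℓ - 200)]
        linarith
      linarith
    have hs : b / 2 ^ (j + 1) = b / 2 ^ j / 2 := by
      rw [pow_succ, ← Nat.div_div_eq_div_mul b (2 ^ j) 2]
    have hmono : 2 * b - b / 2 ^ j ≤ 2 * b - b / 2 ^ (j + 1) := by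
      rw [hs]
      exact Nat.sub_le_sub_left (Nat.div_le_self _ _) _
    have hle : b / 2 ^ j ≤ b := Nat.div_le_self _ _
    -- Keeps the next reserve nonempty, so that integer division loses at most a factor two in
    -- `hYcard`.
    have hpow : (2 : ℝ) ^ (j + 1) ≤ b := by
      have h2j : (2 : ℝ) ^ j * 200 / 12 ≤ k := by
        rw [hk]; push_cast
        rw [mul_div_assoc]
        gcongr
        linarith
      have hkp : (k : ℝ) * (100000 * ℓ / n) ≤ 1 := by
        calc (k : ℝ) * (100000 * ℓ / n) ≤ k * p₂ := by gcongr; linarith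
          _ ≤ 1 := hk1.le
      rw [← mul_div_assoc, div_le_one hn0] at hkp
      have : (k : ℝ) * 100000 ≤ n := by nlinarith
      rw [pow_succ]
      linarith
    have hYcard : (b : ℝ) / 2 ^ (j + 2) ≤
        (initial n (2 * b - b / 2 ^ (j + 1)) \ initial n (2 * b - b / 2 ^ j)).card := by
      rw [card_initial_sdiff hmono ((Nat.sub_le _ _).trans (by omega))]
      set a := b / 2 ^ j with ha
      have h1 : a ≤ 2 * (2 * b - b / 2 ^ (j + 1) - (2 * b - a)) := by
        rw [hs]
        omega
      have h1' : (a : ℝ) ≤ 2 * ((2 * b - b / 2 ^ (j + 1) - (2 * b - a) : ℕ) : ℝ) := by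
        exact_mod_cast h1
      have h2 : (b : ℝ) / 2 ^ j < a + 1 := by
        have := Nat.lt_floor_add_one ((b : ℝ) / ((2 ^ j : ℕ) : ℝ))
        rw [Nat.floor_div_eq_div, ← ha] at this
        simpa using this
      have h3 : 1 ≤ (b : ℝ) / 2 ^ (j + 1) := by rwa [one_le_div (by positivity)]
      rw [pow_succ, ← div_div] at h3
      rw [pow_succ, pow_succ, ← div_div, ← div_div]
      linarith
    have hstep := real_noGrown_union_le p₁ p₂ k (2 * k) (initial n (2 * b - b / 2 ^ j))
      (initial n (2 * b - b / 2 ^ (j + 1)) \ initial n (2 * b - b / 2 ^ j))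
      Finset.disjoint_sdiff (q := (p₁ * k / 2) * (p₂ * k / 2)) ?_
    · rw [initial_union_sdiff hmono] at hstep
      have hchern := two_pow_mul_pow_le (q := (p₁ * k / 2 : ℝ) * (p₂ * k / 2)) (m := 2 * k)
        (N := (initial n (2 * b - b / 2 ^ (j + 1)) \ initial n (2 * b - b / 2 ^ j)).card) ?_ ?_
      · rw [show 2 ^ (j + 1) * L = 2 * k by rw [hk]; ring]
        have he : Real.exp (-((2 * k : ℕ) : ℝ)) ≤ 1 / (2 * k) := by
          push_cast
          exact exp_neg_le_one_div (by positivity)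
        -- The errors `1 / (2k)` with `k = 2 ^ j * L` form a geometric series.
        have hsum : (1 - 1 / (2 : ℝ) ^ (j + 1)) / L = (1 - 1 / (2 : ℝ) ^ j) / L + 1 / (2 * k) := by
          rw [hk]; push_cast
          field_simp
          ring
        rw [hsum]
        linarith
      · have ha : (p₁ * k / 2 : ℝ) ≤ 1 := by nlinarith
        have hb : (p₂ * k / 2 : ℝ) ≤ 1 := by nlinarith
        have hb0 : 0 ≤ (p₂ * k / 2 : ℝ) := by have := p₂.2.1; positivity
        nlinarith
      · have hpp : 0 ≤ (p₁ : ℝ) * p₂ := mul_nonneg p₁.2.1 p₂.2.1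
        have hkL : (k : ℝ) / 2 ^ j = L := by
          rw [hk]; push_cast; field_simp
        -- The success probability is of order `k²` and the reserve of order `n / 2 ^ j`; since `k /
        -- 2 ^ j = L` is of order `ℓ`, the expected gain is a large multiple of `k` in every round.
        calc (4 : ℝ) * ((2 * k : ℕ) : ℝ) = k * 8 := by push_cast; ring
          _ ≤ k * (100000 * L / (128 * ℓ)) := by
              gcongr
              rw [le_div_iff₀ (by positivity)]
              linarith
          _ = (100000 / (n * ℓ)) * k ^ 2 / 4 * (n / 8 / 2 ^ (j + 2)) := by
              rw [← hkL]
              field_simp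
              ring
          _ ≤ (p₁ * p₂) * k ^ 2 / 4 * (b / 2 ^ (j + 2)) := by gcongr
          _ = (p₁ * k / 2 : ℝ) * (p₂ * k / 2) * (b / 2 ^ (j + 2)) := by ring
          _ ≤ _ := by
              refine mul_le_mul_of_nonneg_left hYcard ?_
              have := p₂.2.1
              positivity
    · have hk1' : (p₂ : ℝ) * k ≤ 1 := by linarith
      have hk2' : (p₁ : ℝ) * k ≤ 1 := le_trans (by gcongr) hk1'
      have h0 : 0 ≤ (p₂ : ℝ) * k := mul_nonneg p₂.2.1 hkpos.le
      have e1 := half_le_one_sub_pow hp1' (by positivity) hk2' le_rfl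
      have e2 := half_le_one_sub_pow hp2' h0 hk1' le_rfl
      exact mul_le_mul e1 e2 (by positivity) (le_trans (by positivity) e1)

/-- Some set of size `m`, where `m` is a large multiple of the inverse of the blue edge probability,
grows inside three quarters of the vertices. -/
lemma real_noGrown_large_le (hℓ : 200 ≤ Real.log n) (h21 : (p₁ : ℝ) ≤ p₂)
    (h12 : 100000 / (n * Real.log n) ≤ (p₁ : ℝ) * p₂) (h1 : 100000 * Real.log n / n ≤ (p₁ : ℝ)) :
    (bernoulliPi (edgeProb (V := Fin n) p₁ p₂)).real
      (noGrown ⌈2 * Real.log n / (p₂ : ℝ)⌉₊ (initial n (3 * (n / 4)))) ≤ 14 / Real.log n := by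
  have hseed := real_noGrown_seed_le hℓ h12 h1 (h1.trans h21)
  have hdouble := fun j => real_noGrown_doubling_le hℓ h21 h12 h1 (Nat.le_ceil _) j
  obtain ⟨hcube, hexp, hn0⟩ := eight_mul_log_cube_le hℓ
  set ℓ := Real.log n with hℓdef
  have hℓ0 : 0 < ℓ := by linarith
  set L := ⌈ℓ / 12⌉₊ with hL
  have hL1 : ℓ / 12 ≤ L := Nat.le_ceil _
  have hLpos : (0 : ℝ) < L := by linarith
  have hp1 : 0 < (p₁ : ℝ) := lt_of_lt_of_le (by positivity) h1
  have hp2 : 0 < (p₂ : ℝ) := hp1.trans_le h21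
  have hp1' : (p₁ : ℝ) ≤ 1 := p₁.2.2
  have hp2' : (p₂ : ℝ) ≤ 1 := p₂.2.2
  have hex : ∃ j, 1 ≤ ((2 ^ j * L : ℕ) : ℝ) * p₂ := by
    obtain ⟨j, hj⟩ := pow_unbounded_of_one_lt (1 / (L * p₂ : ℝ)) (one_lt_two)
    refine ⟨j, ?_⟩
    rw [div_lt_iff₀ (by positivity)] at hj
    push_cast
    linarith
  classical
  have hJ := Nat.find_spec hex
  set J := Nat.find hex with hJdef
  have hJmin : ∀ i < J, ((2 ^ i * L : ℕ) : ℝ) * p₂ < 1 := fun i hi => not_le.1 (Nat.find_min hex hi)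
  have hgrown := hdouble J hJmin
  set k := 2 ^ J * L with hk
  have hkpos : (0 : ℝ) < k := by rw [hk]; push_cast; positivity
  set b := n / 4 with hb
  have hbn : 4 * b ≤ n := by omega
  have hnl : 320000 * ℓ ≤ n := by
    have h : 40000 ≤ ℓ ^ 2 := by nlinarith
    calc 320000 * ℓ = 8 * (40000 * ℓ) := by ring
      _ ≤ 8 * (ℓ ^ 2 * ℓ) := by gcongr
      _ = 8 * ℓ ^ 3 := by ring
      _ ≤ n := hcube
  have hb8 : (n : ℝ) / 8 ≤ b := by
    have h4 : n < 4 * b + 4 := by omega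
    have h4' : (n : ℝ) < 4 * b + 4 := by exact_mod_cast h4
    linarith
  set m := ⌈2 * ℓ / (p₂ : ℝ)⌉₊ with hm
  have hm1 : 2 * ℓ / (p₂ : ℝ) ≤ m := Nat.le_ceil _
  have hm2 : (m : ℝ) < 2 * ℓ / p₂ + 1 := Nat.ceil_lt_add_one (by positivity)
  have hℓp : ℓ ≤ ℓ / p₂ := by
    rw [le_div_iff₀ hp2]
    nlinarith
  have hm3 : (m : ℝ) ≤ 3 * (ℓ / p₂) := by
    rw [mul_div_assoc] at hm2
    linarith
  -- As `k p₂ ≥ 1`, a fresh vertex has a blue edge to the cluster with probability at least `1/2`,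
  -- and a red one with probability at least `x / 2`.
  set x := min 1 ((p₁ : ℝ) * k) with hx
  have hx0 : 0 ≤ x := le_min zero_le_one (by positivity)
  have hx1 : x ≤ 1 := min_le_left _ _
  have hstep := real_noGrown_union_le p₁ p₂ k m (initial n (2 * b - b / 2 ^ J))
    (initial n (3 * b) \ initial n (2 * b)) ?_ (q := x / 2 * (1 / 2)) ?_
  · have hanti : noGrown m (initial n (3 * b)) ⊆
        noGrown m (initial n (2 * b - b / 2 ^ J) ∪ (initial n (3 * b) \ initial n (2 * b))) := by
      refine noGrown_anti m (Finset.union_subset (initial_mono ?_) Finset.sdiff_subset)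
      exact (Nat.sub_le _ _).trans (by omega)
    have hchern := two_pow_mul_pow_le (q := x / 2 * (1 / 2)) (m := m)
      (N := (initial n (3 * b) \ initial n (2 * b)).card) (by linarith) ?_
    · have hm4 : ℓ ≤ m := by
        rw [mul_div_assoc] at hm1
        linarith
      have he : Real.exp (-(m : ℝ)) ≤ 1 / ℓ :=
        (exp_neg_le_one_div (by linarith)).trans (by gcongr)
      have hlast : (1 - 1 / (2 : ℝ) ^ J) / L ≤ 12 / ℓ := by
        have : 1 - 1 / (2 : ℝ) ^ J ≤ 1 := by
          have : 0 ≤ 1 / (2 : ℝ) ^ J := by positivity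
          linarith
        rw [div_le_div_iff₀ hLpos hℓ0]
        nlinarith
      -- The errors of the seed, of all doublings (`1 / L ≤ 12 / ℓ`) and of the last round.
      have h14 : 14 / ℓ = 1 / ℓ + 12 / ℓ + 1 / ℓ := by ring
      have := (real_mono (edgeProb (V := Fin n) p₁ p₂) hanti).trans hstep
      rw [h14]
      linarith
    · rw [card_initial_sdiff (by omega) (by omega), show 3 * b - 2 * b = b by omega]
      have h48 : 48 * (ℓ / p₂) ≤ x * (n / 8) := by
        rcases le_total 1 ((p₁ : ℝ) * k) with hc | hc
        · rw [hx, min_eq_left hc, one_mul, ← mul_div_assoc, div_le_div_iff₀ hp2 (by norm_num)]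
          rw [div_le_iff₀ hn0] at h1
          have : (p₁ : ℝ) * n ≤ p₂ * n := by gcongr
          linarith
        · rw [hx, min_eq_right hc, ← mul_div_assoc, div_le_iff₀ hp2]
          rw [div_le_iff₀ hn0] at h1
          calc 48 * ℓ ≤ 100000 * ℓ / 8 * 1 := by linarith
            _ ≤ (p₁ * n) / 8 * (k * p₂) := by gcongr
            _ = p₁ * k * (n / 8) * p₂ := by ring
      have : x * (n / 8) ≤ x * b := by gcongr
      linarith
  · exact Finset.disjoint_sdiff.mono_left (initial_mono (Nat.sub_le _ _))
  · have e1 := half_le_one_sub_pow hp1' hx0 hx1 (min_le_right 1 ((p₁ : ℝ) * k))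
    have e2 := half_le_one_sub_pow (k := k) hp2' zero_le_one le_rfl (by linarith)
    exact mul_le_mul e1 e2 (by norm_num) (le_trans (by positivity) e1)

lemma one_sub_percolationProb_le_div_log (hℓ : 200 ≤ Real.log n) (h21 : (p₁ : ℝ) ≤ p₂)
    (h12 : 100000 / (n * Real.log n) ≤ (p₁ : ℝ) * p₂) (h1 : 100000 * Real.log n / n ≤ (p₁ : ℝ)) :
    1 - percolationProb n p₁ p₂ ≤ 19 / Real.log n := by
  have hlarge := real_noGrown_large_le hℓ h21 h12 h1
  obtain ⟨hcube, hexp, hn0⟩ := eight_mul_log_cube_le hℓ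
  set ℓ := Real.log n with hℓdef
  have hℓ0 : 0 < ℓ := by linarith
  have hp1 : 0 < (p₁ : ℝ) := lt_of_lt_of_le (by positivity) h1
  have hp2 : 0 < (p₂ : ℝ) := hp1.trans_le h21
  have hp1' : (p₁ : ℝ) ≤ 1 := p₁.2.2
  have hp2' : (p₂ : ℝ) ≤ 1 := p₂.2.2
  set m := ⌈2 * ℓ / (p₂ : ℝ)⌉₊ with hm
  have hm1 : 2 * ℓ / (p₂ : ℝ) ≤ m := Nat.le_ceil _
  have hmpos : 1 ≤ m := Nat.ceil_pos.2 (by positivity)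
  have hmain := one_sub_percolationProb_le n p₁ p₂ hmpos (initial n (3 * (n / 4)))
    (Finset.univ \ initial n (3 * (n / 4))) Finset.disjoint_sdiff
  set N := (Finset.univ \ initial n (3 * (n / 4))).card with hN
  have hNeq : N = n - 3 * (n / 4) := by
    rw [hN, Finset.card_sdiff_of_subset (Finset.subset_univ _), card_initial (by omega),
      Finset.card_univ, Fintype.card_fin]
  have hn3 : 64 ≤ n := by
    have h : (64 : ℝ) ≤ n := by nlinarith [mul_self_nonneg (ℓ - 200)]
    exact_mod_cast h
  have hNn : (N : ℝ) ≤ n := by exact_mod_cast (by omega : N ≤ n)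
  have hN16 : (n : ℝ) / 16 ≤ (N / 2 : ℕ) := by
    have : n ≤ 16 * (N / 2) := by omega
    have : (n : ℝ) ≤ 16 * (N / 2 : ℕ) := by exact_mod_cast this
    linarith
  have hNhalf : ((N / 2 : ℕ) : ℝ) ≤ N := by exact_mod_cast Nat.div_le_self N 2
  have he2 : Real.exp (-(2 * ℓ)) = 1 / (n : ℝ) ^ 2 := by
    rw [Real.exp_neg, two_mul, Real.exp_add, hexp, ← sq, one_div]
  -- A linear number of independent edges of probability at least `100000 ℓ / n` is absent with
  -- probability at most `n⁻²`, enough for a union bound over the vertices.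
  have hsmall : ∀ (p : ℝ) (k : ℕ), p₁ ≤ p → p ≤ 1 → (n : ℝ) / 16 ≤ k →
      (1 - p) ^ k ≤ 1 / (n : ℝ) ^ 2 := by
    intro p k hp hp' hk
    rw [← he2]
    refine (one_sub_pow_le_exp hp' k).trans (Real.exp_le_exp.2 (neg_le_neg ?_))
    calc 2 * ℓ ≤ (100000 * ℓ / n) * (n / 16) := by
          field_simp
          norm_num
      _ ≤ p * k := by
          have : 0 ≤ p := hp1.le.trans hp
          gcongr
          exact h1.trans hp
  have hA : N * (1 - (p₂ : ℝ)) ^ m ≤ 1 / n := by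
    have : (1 - (p₂ : ℝ)) ^ m ≤ 1 / (n : ℝ) ^ 2 := by
      rw [← he2]
      refine (one_sub_pow_le_exp hp2' m).trans (Real.exp_le_exp.2 (neg_le_neg ?_))
      rw [div_le_iff₀ hp2] at hm1
      linarith
    calc N * (1 - (p₂ : ℝ)) ^ m ≤ n * (1 / (n : ℝ) ^ 2) := by
          refine mul_le_mul hNn this (pow_nonneg (by linarith) _) hn0.le
      _ = 1 / n := by field_simp
  have hB : (1 + (1 - (p₁ : ℝ)) ^ (N / 2)) ^ N - 1 ≤ 2 / n := by
    have h := hsmall p₁ (N / 2) le_rfl hp1' hN16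
    have hpos : 0 ≤ (1 - (p₁ : ℝ)) ^ (N / 2) := pow_nonneg (by linarith) _
    have hle : (1 + (1 - (p₁ : ℝ)) ^ (N / 2)) ^ N ≤ Real.exp (1 / n) := by
      calc (1 + (1 - (p₁ : ℝ)) ^ (N / 2)) ^ N ≤ Real.exp (1 / (n : ℝ) ^ 2) ^ N := by
            refine pow_le_pow_left₀ (by linarith) ?_ N
            linarith [Real.add_one_le_exp (1 / (n : ℝ) ^ 2)]
        _ = Real.exp (N * (1 / (n : ℝ) ^ 2)) := by rw [← Real.exp_nat_mul]
        _ ≤ Real.exp (1 / n) := by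
            refine Real.exp_le_exp.2 ?_
            calc (N : ℝ) * (1 / (n : ℝ) ^ 2) ≤ (n : ℝ) * (1 / (n : ℝ) ^ 2) := by gcongr
              _ = 1 / (n : ℝ) := by field_simp
    have habs := Real.abs_exp_sub_one_le (x := 1 / (n : ℝ)) (by
      rw [abs_of_pos (by positivity), div_le_one hn0]
      have : (64 : ℝ) ≤ n := by exact_mod_cast hn3
      linarith)
    rw [abs_of_pos (show (0 : ℝ) < 1 / n by positivity)] at habs
    have := le_abs_self (Real.exp (1 / (n : ℝ)) - 1)
    have h2 : 2 / (n : ℝ) = 2 * (1 / n) := by ring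
    linarith
  have hC : n * ((1 - (p₁ : ℝ)) ^ N + (1 - (p₂ : ℝ)) ^ N) ≤ 2 / n := by
    have e1 := hsmall p₁ N le_rfl hp1' (hN16.trans hNhalf)
    have e2 := hsmall p₂ N h21 hp2' (hN16.trans hNhalf)
    calc n * ((1 - (p₁ : ℝ)) ^ N + (1 - (p₂ : ℝ)) ^ N) ≤
          n * (1 / (n : ℝ) ^ 2 + 1 / (n : ℝ) ^ 2) := by gcongr
      _ = 2 / n := by field_simp; norm_num
  have hnl : 5 / (n : ℝ) ≤ 5 / ℓ := by
    gcongr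
    nlinarith [mul_self_nonneg (ℓ - 200)]
  have h5 : 5 / (n : ℝ) = 1 / n + 2 / n + 2 / n := by ring
  have h19 : 19 / ℓ = 14 / ℓ + 5 / ℓ := by ring
  linarith

lemma tendsto_percolationProb_one (p₁ p₂ : ℕ → unitInterval)
    (h : ∀ᶠ n : ℕ in atTop, 100000 / (n * Real.log n) ≤ (p₁ n : ℝ) * (p₂ n : ℝ) ∧
      100000 * Real.log n / n ≤ min (p₁ n : ℝ) (p₂ n : ℝ)) :
    Tendsto (fun n : ℕ => percolationProb n (p₁ n) (p₂ n)) atTop (𝓝 1) := by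
  have hlog : Tendsto (fun n : ℕ => Real.log n) atTop atTop :=
    Real.tendsto_log_atTop.comp tendsto_natCast_atTop_atTop
  have hlim : Tendsto (fun n : ℕ => 1 - 19 / Real.log n) atTop (𝓝 1) := by
    simpa using (hlog.const_div_atTop 19).const_sub 1
  refine tendsto_of_tendsto_of_tendsto_of_le_of_le' hlim tendsto_const_nhds ?_
    (Eventually.of_forall fun n => measureReal_le_one)
  filter_upwards [h, hlog.eventually_ge_atTop 200] with n hn hℓ
  rcases le_total (p₁ n : ℝ) (p₂ n) with hle | hle
  · have := one_sub_percolationProb_le_div_log hℓ hle hn.1 (hn.2.trans (min_le_left _ _))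
    linarith
  · rw [percolationProb_symm]
    have := one_sub_percolationProb_le_div_log hℓ hle (by rw [mul_comm (p₂ n : ℝ)]; exact hn.1)
      (hn.2.trans (min_le_right _ _))
    linarith

end Doubling

end Jigsaw

theorem theorem1 :
    ∃ c : ℝ, 0 < c ∧ ∀ p₁ p₂ : ℕ → unitInterval,
      ((∀ᶠ n : ℕ in atTop, (p₁ n : ℝ) * (p₂ n : ℝ) ≤ 1 / (c * n * Real.log n)) →
        Tendsto (fun n : ℕ => Jigsaw.percolationProb n (p₁ n) (p₂ n)) atTop (𝓝 0)) ∧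
      ((∀ᶠ n : ℕ in atTop, c / (n * Real.log n) ≤ (p₁ n : ℝ) * (p₂ n : ℝ) ∧
          c * Real.log n / n ≤ min (p₁ n : ℝ) (p₂ n : ℝ)) →
        Tendsto (fun n : ℕ => Jigsaw.percolationProb n (p₁ n) (p₂ n)) atTop (𝓝 1)) :=
  -- Part (i) only needs `c ≥ 1000`; the value is dictated by part (ii).
  ⟨100000, by norm_num, fun p₁ p₂ =>
    ⟨Jigsaw.tendsto_percolationProb_zero (by norm_num) p₁ p₂,
      Jigsaw.tendsto_percolationProb_one p₁ p₂⟩⟩
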